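/- **Setting.** For each $N\ge 1$ let $x=(x_1,\dots,x_N)$ have i.i.d. entries with law $\pi_X\neq\delta_0$, and let $Z=(Z_{ij})_{i,j\le N}$ be symmetric, independent of $x$, with $(Z_{ij})_{i\le j}$ i.i.d. of law $\mu_Z$. The probability laws $\pi_X,\mu_Z$ on $\mathbb R$ do not depend on $N$ and have stretched exponential tails with exponents $\alpha_X,\alpha_Z>0$, i.e. $\mathbb P(|X|>M)\le Ce^{-cM^{\alpha}}$ for all $M>0$, for some $C,c>0$ (with $\alpha=\alpha_X$, resp. $\alpha_Z$). For $f:\mathbb R\to\mathbb R$ and $\gamma:\mathbb N\to\mathbb R$ put $$Y_{ij}=\tfrac1{\sqrt N}\Big[f\big(Z_{ij}+\tfrac{\gamma(N)}{\sqrt N}x_ix_j\big)-\mathbb E f(Z_{ij})\Big].$$ For sufficiently smooth $g$ write $\vartheta_j(g)=\mathbb E_{\mu_Z}\,g^{(j)}(Z)$. Events $A_N$ occur *with high probability* if $\mathbb P(A_N)\ge 1-CN^{-c}$ for all $N\ge1$, for some constants $c,C>0$. The function $f$ is assumed to satisfy (S) or (A), with information index $k_\star\ge 1$: * (S) $k_\star$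 is the least $k\ge1$ with $\vartheta_k(f)\ne0$, $f\in C^{k_\star+1}$, $f^{(k)}\in L^4(\mu_Z)$ for $0\le k\le k_\star$, and $f^{(k_\star+1)}$ is bounded. * (A) $f\in L^4(\mu_Z)$; on every $[-L,L]$, $L>0$, $f$ is Lipschitz with constant at most $R(L)$ for some polynomial $R$; and there are compactly supported $f_t\in C^\infty$, $t\in\mathbb N$, with $f_t\to f$ in $L^4(\mu_Z)$, $f_t^{(k)}\in L^4(\mu_Z)$ for $k\le k_\star$, $f_t^{(k_\star+1)}$ bounded, $\vartheta_k(f_t)\to0$ for $1\le k<k_\star$, and $\vartheta_{k_\star}(f_t)$ convergent to a non-zero limit, which is denoted $\vartheta_{k_\star}(f)$. The spike is $$P=\frac{\gamma(N)^{k_\star}}{N^{\frac{k_\star}2-\frac12}}\,\frac{\vartheta_{k_\star}(f)}{k_\star!}\,\frac{x^{k_\star}}{\sqrt N}\Big(\frac{x^{k_\star}}{\sqrt N}\Big)^{\!\top},\qquad x^{k}:=(x_1^k,\dots,x_N^k).$$ We say that $P$ is *of order one* if there are $0<a\le b$ such that, with high probability, $P$ has exactly one non-zero eigenvalue $\lambda$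 and $a\le|\lambda|\le b$. **Corollary (Relevant scaling).** 1. Under (S) or (A), the scaling of the SNR at which $P$ is of order one is $N^{\frac12(1-1/k_\star)}$. That is, for every sequence $\gamma(N)$, $P$ is of order one if and only if $|\gamma(N)|$ lies, for all large $N$, between two positive constant multiples of $N^{\frac12(1-1/k_\star)}$; in particular $P$ is of order one when $\gamma(N)=\gamma_0N^{\frac12(1-1/k_\star)}$ with $\gamma_0\neq0$. Moreover $\gamma(N)=\gamma_0N^{\frac12(1-1/k_\star)}$ satisfies $Q(\log N)\,|\gamma(N)|^{k_\star+1}N^{-k_\star/2}\to0$ for every polynomial $Q$. 2. There is a polynomial $Q$, depending only on $\alpha_X,\alpha_Z,k_\star$, such that if $f$ satisfies (S) and $\gamma(N)=\gamma_0N^{\frac12(1-1/k_\star)}$, $\gamma_0\in\mathbb R$, then for all $N\ge 1$ $$Y\overset{\mathcal D}{=}\sqrt{\vartheta_0(f^2)-\vartheta_0(f)^2}\;W+P+E,$$ an equality in law that holds jointly with the signal $x$. Here $W$ is a symmetric random matrix independent of $x$ (hence of $P$) such that the $\sqrt N\,W_{ij}$, $i\le j$, are i.i.d. with a law independent of $N$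 of mean $0$, variance $1$ and finite fourth moment; and $E$ is a symmetric random matrix with $$\|E\|_{\mathrm{op}}=O\big(Q(\log N)\,N^{-1/(2k_\star)}\big)\quad\text{with high probability},\qquad Q(\log N)\,N^{-1/(2k_\star)}\to0,$$ where the constant in $O(\cdot)$ does not depend on $N$. -/

import Mathlib

open MeasureTheory ProbabilityTheory Filter Topology Asymptotics

noncomputable section

/-! ### Probabilistic vocabulary -/

/-- The law `ρ` on `ℝ` has stretched exponential tails with exponent `α > 0`. -/
def HasStretchedExpTails (ρ : Measure ℝ) (α : ℝ) : Prop :=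
  0 < α ∧ ∃ C c : ℝ, 0 < C ∧ 0 < c ∧
    ∀ M : ℝ, 0 < M → ρ.real {x | M < |x|} ≤ C * Real.exp (-(c * M ^ α))

/-- The events `A N` occur with high probability: for some constants `c, C > 0` independent of
`N`, the event `A N` has probability at least `1 - C N^{-c}` for every `N ≥ 1`. -/
def WithHighProbability {Ω : ℕ → Type*} [∀ N, MeasurableSpace (Ω N)]
    (P : ∀ N, Measure (Ω N)) (A : ∀ N, Set (Ω N)) : Prop :=
  ∃ c C : ℝ, 0 < c ∧ 0 < C ∧
    ∀ N : ℕ, 1 ≤ N → 1 - C * (N : ℝ) ^ (-c) ≤ (P N).real (A N)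

/-- The random matrix `A` is symmetric and its entries on and above the diagonal are iid with
law `ρ`. -/
structure IsIidSymmetric {N : ℕ} {Ω : Type*} [MeasurableSpace Ω] (P : Measure Ω)
    (ρ : Measure ℝ) (A : Ω → Matrix (Fin N) (Fin N) ℝ) : Prop where
  symm : ∀ ω, (A ω).IsSymm
  law : ∀ i j, i ≤ j → HasLaw (fun ω => A ω i j) ρ P
  indep : iIndepFun (fun (p : {p : Fin N × Fin N // p.1 ≤ p.2}) (ω : Ω) => A ω p.1.1 p.1.2) P

/-- The signal vector `x` has iid entries with law `ρX`, the noise matrix `Z` is symmetric with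
iid entries of law `μ` on and above the diagonal, and signal and noise are independent. -/
structure IsSignalAndNoise {N : ℕ} {Ω : Type*} [MeasurableSpace Ω] (P : Measure Ω)
    (ρX μ : Measure ℝ) (x : Ω → Fin N → ℝ) (Z : Ω → Matrix (Fin N) (Fin N) ℝ) : Prop where
  signal_law : ∀ i, HasLaw (fun ω => x ω i) ρX P
  signal_indep : iIndepFun (fun (i : Fin N) (ω : Ω) => x ω i) P
  noise : IsIidSymmetric P μ Z
  indep : IndepFun x (fun ω i j => Z ω i j) P

/-- Entry laws of centered and normalized Wigner matrices with bounded fourth moment: mean zero,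
variance one, finite fourth moment. -/
structure IsNormalizedEntryLaw (ν : Measure ℝ) : Prop where
  prob : IsProbabilityMeasure ν
  fourth : MemLp (fun w : ℝ => w) 4 ν
  mean : ∫ w, w ∂ν = 0
  variance : ∫ w, w ^ 2 ∂ν = 1

/-! ### Information coefficients and the hypotheses on the non-linearity -/

/-- The `j`-th information coefficient `ϑ_j(f) = 𝔼 f^{(j)}(Z)`, `Z ∼ μ`, of a smooth enough `f`. -/
def infoCoeff (μ : Measure ℝ) (j : ℕ) (f : ℝ → ℝ) : ℝ := ∫ z, iteratedDeriv j f z ∂μ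

/-- The smooth case: `k` is the information index of `f`, `f` is `C^{k+1}`, its derivatives of
order at most `k` are in `L⁴(μ)`, and the derivative of order `k + 1` is bounded. -/
structure IsSmoothWithIndex (μ : Measure ℝ) (k : ℕ) (f : ℝ → ℝ) : Prop where
  contDiff : ContDiff ℝ (k + 1 : ℕ) f
  memLp : ∀ j ≤ k, MemLp (iteratedDeriv j f) 4 μ
  bounded : ∃ B : ℝ, ∀ z, |iteratedDeriv (k + 1) f z| ≤ B
  index : IsLeast {j : ℕ | 1 ≤ j ∧ infoCoeff μ j f ≠ 0} k

/-- On each `[-L, L]` the function `f` is Lipschitz, with a constant bounded by a polynomial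
in `L`. -/
def IsLocLipschitzPoly (f : ℝ → ℝ) : Prop :=
  ∃ R : Polynomial ℝ, ∀ L : ℝ, 0 < L → ∀ x y : ℝ, |x| ≤ L → |y| ≤ L →
    |f x - f y| ≤ R.eval L * |x - y|

/-- The non-smooth case: `f ∈ L⁴(μ)` is locally Lipschitz with polynomial constant and is
the limit in `L⁴(μ)` of smooth compactly supported functions `g t` whose information coefficients
of orders `1, …, k - 1` tend to zero and whose coefficient of order `k` tends to `θ ≠ 0`. Then
`k` is the information index of `f`, and `θ` plays the role of `ϑ_k(f)`. -/
structure IsApproximableWithIndex (μ : Measure ℝ) (k : ℕ) (θ : ℝ) (f : ℝ → ℝ) : Prop where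
  memLp : MemLp f 4 μ
  locLipschitz : IsLocLipschitzPoly f
  index_pos : 1 ≤ k
  coeff_ne_zero : θ ≠ 0
  approx : ∃ g : ℕ → ℝ → ℝ,
    (∀ t, ContDiff ℝ (⊤ : ℕ∞) (g t)) ∧
    (∀ t, HasCompactSupport (g t)) ∧
    Tendsto (fun t => eLpNorm (fun z => g t z - f z) 4 μ) atTop (𝓝 0) ∧
    (∀ t, ∀ j ≤ k, MemLp (iteratedDeriv j (g t)) 4 μ) ∧
    (∀ t, ∃ B : ℝ, ∀ z, |iteratedDeriv (k + 1) (g t) z| ≤ B) ∧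
    (∀ j, 1 ≤ j → j < k → Tendsto (fun t => infoCoeff μ j (g t)) atTop (𝓝 0)) ∧
    Tendsto (fun t => infoCoeff μ k (g t)) atTop (𝓝 θ)

/-- `f` satisfies one of the two alternative hypotheses, with information index `k` and leading
information coefficient `ϑ_k(f) = θ`. -/
def HasInfoIndex (μ : Measure ℝ) (k : ℕ) (θ : ℝ) (f : ℝ → ℝ) : Prop :=
  IsApproximableWithIndex μ k θ f ∨ (IsSmoothWithIndex μ k f ∧ θ = infoCoeff μ k f)

/-! ### The matrices of the model -/

/-- Operator norm of a matrix with respect to the Euclidean norm. -/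
def opNorm {N : ℕ} (A : Matrix (Fin N) (Fin N) ℝ) : ℝ :=
  ‖Matrix.toEuclideanCLM (n := Fin N) (𝕜 := ℝ) A‖

/-- The non-linear matrix `Y_{ij} = N^{-1/2} (f(Z_{ij} + γ N^{-1/2} x_i x_j) - 𝔼 f(Z_{ij}))`. -/
def nonlinearMatrix {N : ℕ} (μ : Measure ℝ) (f : ℝ → ℝ) (γ : ℝ) (x : Fin N → ℝ)
    (Z : Matrix (Fin N) (Fin N) ℝ) : Matrix (Fin N) (Fin N) ℝ :=
  Matrix.of fun i j =>
    1 / √(N : ℝ) * (f (Z i j + γ / √(N : ℝ) * x i * x j) - ∫ z, f z ∂μ)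

/-- The spike `P = γ^k N^{-(k/2 - 1/2)} (θ / k!) (x^k / √N) (x^k / √N)ᵀ`. -/
def spikeMatrix {N : ℕ} (k : ℕ) (θ γ : ℝ) (x : Fin N → ℝ) : Matrix (Fin N) (Fin N) ℝ :=
  (γ ^ k / (N : ℝ) ^ ((k : ℝ) / 2 - 1 / 2) * (θ / (k.factorial : ℝ))) •
    Matrix.vecMulVec (fun i => x i ^ k / √(N : ℝ)) (fun i => x i ^ k / √(N : ℝ))

/-- The standard deviation `√(ϑ_0(f²) - ϑ_0(f)²)` of `f(Z)`. -/
def noiseLevel (μ : Measure ℝ) (f : ℝ → ℝ) : ℝ :=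
  √(infoCoeff μ 0 (fun z => f z ^ 2) - infoCoeff μ 0 f ^ 2)

/-- The scaling `γ₀ N^{(1 - 1/k)/2}` of the signal-to-noise ratio. -/
def relevantSNR (k : ℕ) (γ₀ : ℝ) (N : ℕ) : ℝ :=
  γ₀ * (N : ℝ) ^ ((1 - 1 / (k : ℝ)) / 2)

/-- The growth condition `Q(log N) |γ(N)|^{k+1} / N^{k/2} → 0` for every polynomial `Q`. -/
def IsAdmissibleSNR (k : ℕ) (γ : ℕ → ℝ) : Prop :=
  ∀ Q : Polynomial ℝ, Tendsto
    (fun N : ℕ => Q.eval (Real.log N) * |γ N| ^ (k + 1) / (N : ℝ) ^ ((k : ℝ) / 2)) atTop (𝓝 0)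

/-- The spikes built from the random signals `x N` and the signal-to-noise ratios `γ N` are of
order one: there are constants `0 < a ≤ b` such that with high probability `P` has exactly one
non-zero eigenvalue `l`, and `a ≤ |l| ≤ b`. -/
def SpikeIsOrderOne {Ω : ℕ → Type*} [∀ N, MeasurableSpace (Ω N)] (P : ∀ N, Measure (Ω N))
    (k : ℕ) (θ : ℝ) (γ : ℕ → ℝ) (x : ∀ N, Ω N → Fin N → ℝ) : Prop :=
  ∃ a b : ℝ, 0 < a ∧ a ≤ b ∧ WithHighProbability P fun N =>
    {ω | ∃ l : ℝ, spectrum ℝ (spikeMatrix k θ (γ N) (x N ω)) \ {0} = {l} ∧ a ≤ |l| ∧ |l| ≤ b}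

/-- The non-linear matrices `Y` built from `x`, `Z` and the signal-to-noise ratios `γ N` are
equal in law to `noiseLevel • W + P + E`, where `W` is a centered and normalized Wigner matrix
with bounded fourth moment, independent of the signal (hence of `P`), `P` is the spike, and
`E` is symmetric with operator norm `O(r N)` with high probability. The equality in law is that
of the pairs (signal, matrix). -/
def HasSpikedDecomposition {Ω : ℕ → Type*} [∀ N, MeasurableSpace (Ω N)]
    (P : ∀ N, Measure (Ω N)) (μ : Measure ℝ) (f : ℝ → ℝ) (k : ℕ) (γ : ℕ → ℝ) (r : ℕ → ℝ)
    (x : ∀ N, Ω N → Fin N → ℝ) (Z : ∀ N, Ω N → Matrix (Fin N) (Fin N) ℝ) : Prop :=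
  ∃ (ν : Measure ℝ) (Ω' : ℕ → Type) (_ : ∀ N, MeasurableSpace (Ω' N))
    (P' : ∀ N, Measure (Ω' N)) (x' : ∀ N, Ω' N → Fin N → ℝ)
    (W E : ∀ N, Ω' N → Matrix (Fin N) (Fin N) ℝ),
    IsNormalizedEntryLaw ν ∧
    (∀ N : ℕ, 1 ≤ N →
      IsProbabilityMeasure (P' N) ∧
      IsIidSymmetric (P' N) ν (fun ω => √(N : ℝ) • W N ω) ∧
      IndepFun (fun ω i j => W N ω i j) (x' N) (P' N) ∧
      (∀ ω, (E N ω).IsSymm) ∧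
      IdentDistrib
        (fun ω => (x N ω, fun i j => nonlinearMatrix μ f (γ N) (x N ω) (Z N ω) i j))
        (fun ω => (x' N ω, fun i j =>
          (noiseLevel μ f • W N ω + spikeMatrix k (infoCoeff μ k f) (γ N) (x' N ω) + E N ω) i j))
        (P N) (P' N)) ∧
    ∃ K : ℝ, 0 < K ∧ WithHighProbability P' fun N => {ω | opNorm (E N ω) ≤ K * r N}

end

/-!
The spike is a rank-one matrix `c v vᵀ`, so its only possible non-zero eigenvalue is `c |v|²`. In
absolute value this is `(|γ| / N^((1 - 1/k)/2))^k (|θ| / k!)` times the empirical moment of order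
`2k` of the signal. That moment concentrates around a positive constant by Chebyshev's inequality
(`exists_measureReal_empirical_moment_le`), because stretched exponential tails give moments of all
orders. Hence the eigenvalue is bounded and bounded away from zero exactly when `|γ|` is comparable
to `N^((1 - 1/k)/2)` (`spikeIsOrderOne_iff`).

For the decomposition, `f (Z i j + γ N^(-1/2) x i x j)` is expanded to order `k` around `Z i j`
(`nonlinearMatrix_eq_expansion`). The term of order zero, once centered, is the Wigner matrix. A
term of order `1 ≤ l ≤ k` is `D^l A D^l`, up to a scalar, with `D` the diagonal matrix of the
signal and `A` the matrix of the `f^(l) (Z i j)`. The mean of `A` vanishes for `l < k`, and for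
`l = k` it produces the spike. What remains is the Taylor remainder, which is bounded entrywise, and
the centered matrices `A - 𝔼 A`. The latter have norm `√N` up to powers of `log N`
(`exists_measureReal_opNorm_symMatrix_le`): since `f^(k+1)` is bounded, `f^(l)` grows at most
polynomially, so the entries can be truncated at a logarithmic scale, and truncated entries are
sub-Gaussian. For sub-Gaussian entries the quadratic form at a fixed vector has Gaussian tails, and
passing to the supremum over vectors costs a factor `8^N`, the ratio of the volumes of two
concentric balls (`measureReal_lt_opNorm_symMatrix_le`). At the relevant scaling
`γ / √N = γ₀ N^(-1/(2k))`, and every error term carries at least one such factor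
(`opNorm_expansion_error_le`).

The decomposition is realized on a product space (`signalNoiseMeasure`) on which the error is
*defined* as the difference of the two sides, so that the equality in law reduces to that of signal
and noise. The product space also carries auxiliary Gaussian variables, from which the Wigner matrix
is built when `f(Z)` is almost surely constant.
-/

/-! ### Taylor expansion and polynomial growth -/

/-- Taylor's formula on the whole line, with a remainder bounded through the derivative of order
`n`. The constant is not optimal: a factor `1 / n!` is dropped. -/
theorem abs_sub_taylor_le {B : ℝ} (n : ℕ) {g : ℝ → ℝ} (hg : ContDiff ℝ n g)
    (hB : ∀ z, |iteratedDeriv n g z| ≤ B) (z h : ℝ) :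
    |g (z + h) - ∑ l ∈ Finset.range n, iteratedDeriv l g z / (l.factorial : ℝ) * h ^ l|
      ≤ B * |h| ^ n := by
  induction n generalizing g h with
  | zero => simpa using hB (z + h)
  | succ n ih =>
    have hB0 : 0 ≤ B := (abs_nonneg _).trans (hB 0)
    have hd : Differentiable ℝ g := hg.differentiable (by simp)
    have hg' : ContDiff ℝ n (deriv g) := by
      have := (contDiff_succ_iff_deriv (n := (n : WithTop ℕ∞))).1 (by exact_mod_cast hg)
      exact this.2.2
    have ih' := fun t => ih hg' (by simpa only [iteratedDeriv_succ'] using hB) t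
    set φ : ℝ → ℝ := fun t =>
      g (z + t) - ∑ l ∈ Finset.range (n + 1), iteratedDeriv l g z / (l.factorial : ℝ) * t ^ l
      with hφ
    have hφd : ∀ t, HasDerivAt φ (deriv g (z + t) -
        ∑ l ∈ Finset.range n, iteratedDeriv l (deriv g) z / (l.factorial : ℝ) * t ^ l) t := by
      intro t
      refine HasDerivAt.sub ((hd (z + t)).hasDerivAt.comp_const_add z t) ?_
      rw [show (fun t : ℝ => ∑ l ∈ Finset.range (n + 1),
          iteratedDeriv l g z / (l.factorial : ℝ) * t ^ l) = fun t : ℝ =>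
          (∑ l ∈ Finset.range n,
            iteratedDeriv l (deriv g) z / ((l + 1).factorial : ℝ) * t ^ (l + 1)) + g z by
        funext t; rw [Finset.sum_range_succ']; simp [iteratedDeriv_succ']]
      refine HasDerivAt.add_const _ (HasDerivAt.fun_sum fun l _ => ?_)
      refine ((hasDerivAt_pow (l + 1) t).const_mul _).congr_deriv ?_
      have : (l.factorial : ℝ) ≠ 0 := by positivity
      rw [Nat.factorial_succ]; push_cast
      field_simp
    have hmv := (convex_Icc (-|h|) |h|).norm_image_sub_le_of_norm_hasDerivWithin_le
      (f := φ) (C := B * |h| ^ n) (x := 0) (y := h) (fun t _ => (hφd t).hasDerivWithinAt)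
      (fun t ht => (ih' t).trans (by
        have : |t| ≤ |h| := abs_le.2 ht
        gcongr)) (by simp) (abs_le.1 le_rfl)
    have h0 : φ 0 = 0 := by
      simp [hφ, Finset.sum_range_succ']
    rw [h0] at hmv
    simpa [Real.norm_eq_abs, hφ, pow_succ, mul_assoc] using hmv

/-- A function with a bounded derivative of order `n` grows at most like a polynomial of degree `n`,
by Taylor's formula at the origin. -/
theorem exists_abs_le_one_add_abs_pow {B : ℝ} (n : ℕ) {g : ℝ → ℝ} (hg : ContDiff ℝ n g)
    (hB : ∀ z, |iteratedDeriv n g z| ≤ B) :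
    ∃ D : ℝ, 0 ≤ D ∧ ∀ z, |g z| ≤ D * (1 + |z|) ^ n := by
  have hB0 : 0 ≤ B := (abs_nonneg _).trans (hB 0)
  refine ⟨(∑ l ∈ Finset.range n, |iteratedDeriv l g 0 / (l.factorial : ℝ)|) + B, by positivity,
    fun z => ?_⟩
  have ht := abs_sub_taylor_le n hg hB 0 z
  rw [zero_add] at ht
  have h1 : |∑ l ∈ Finset.range n, iteratedDeriv l g 0 / (l.factorial : ℝ) * z ^ l| ≤
      (∑ l ∈ Finset.range n, |iteratedDeriv l g 0 / (l.factorial : ℝ)|) * (1 + |z|) ^ n := by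
    rw [Finset.sum_mul]
    refine (Finset.abs_sum_le_sum_abs _ _).trans (Finset.sum_le_sum fun l hl => ?_)
    rw [abs_mul, abs_pow]
    gcongr
    calc |z| ^ l ≤ (1 + |z|) ^ l := by gcongr; linarith
      _ ≤ (1 + |z|) ^ n := pow_le_pow_right₀ (by linarith [abs_nonneg z])
          (Finset.mem_range.1 hl).le
  have h2 : B * |z| ^ n ≤ B * (1 + |z|) ^ n := by gcongr; linarith
  have h3 := abs_sub_abs_le_abs_sub (g z)
    (∑ l ∈ Finset.range n, iteratedDeriv l g 0 / (l.factorial : ℝ) * z ^ l)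
  rw [add_mul]
  linarith

theorem iteratedDeriv_iteratedDeriv (m n : ℕ) (g : ℝ → ℝ) :
    iteratedDeriv m (iteratedDeriv n g) = iteratedDeriv (m + n) g := by
  simp only [iteratedDeriv_eq_iterate, Function.iterate_add_apply]

theorem exists_abs_iteratedDeriv_le {B : ℝ} {n l : ℕ} (hl : l ≤ n) {g : ℝ → ℝ}
    (hg : ContDiff ℝ n g) (hB : ∀ z, |iteratedDeriv n g z| ≤ B) :
    ∃ D : ℝ, 0 ≤ D ∧ ∀ z, |iteratedDeriv l g z| ≤ D * (1 + |z|) ^ n := by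
  obtain ⟨m, rfl⟩ := Nat.exists_eq_add_of_le' hl
  obtain ⟨D, hD, h⟩ := exists_abs_le_one_add_abs_pow (B := B) m (g := iteratedDeriv l g)
    (by
      rw [iteratedDeriv_eq_iterate]
      exact ContDiff.iterate_deriv' m l (by exact_mod_cast hg))
    (by simpa only [iteratedDeriv_iteratedDeriv] using hB)
  refine ⟨D, hD, fun z => (h z).trans ?_⟩
  gcongr
  · linarith [abs_nonneg z]
  · omega

/-! ### Bounds for the operator norm -/

section OpNorm

variable {N : ℕ}

theorem opNorm_nonneg (A : Matrix (Fin N) (Fin N) ℝ) : 0 ≤ opNorm A := norm_nonneg _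

theorem opNorm_add_le (A B : Matrix (Fin N) (Fin N) ℝ) :
    opNorm (A + B) ≤ opNorm A + opNorm B := by
  simpa [opNorm, map_add] using norm_add_le (Matrix.toEuclideanCLM (n := Fin N) (𝕜 := ℝ) A) _

theorem opNorm_smul (c : ℝ) (A : Matrix (Fin N) (Fin N) ℝ) :
    opNorm (c • A) = |c| * opNorm A := by
  simp [opNorm, map_smul, norm_smul]

theorem opNorm_sum_le {ι : Type*} (s : Finset ι) (A : ι → Matrix (Fin N) (Fin N) ℝ) :
    opNorm (∑ i ∈ s, A i) ≤ ∑ i ∈ s, opNorm (A i) := by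
  simpa [opNorm, map_sum] using
    norm_sum_le s fun i => Matrix.toEuclideanCLM (n := Fin N) (𝕜 := ℝ) (A i)

theorem opNorm_mul_le (A B : Matrix (Fin N) (Fin N) ℝ) :
    opNorm (A * B) ≤ opNorm A * opNorm B := by
  simpa [opNorm, map_mul] using norm_mul_le (Matrix.toEuclideanCLM (n := Fin N) (𝕜 := ℝ) A) _

open scoped Matrix.Norms.L2Operator in
theorem opNorm_diagonal_le {d : Fin N → ℝ} {M : ℝ} (hM : 0 ≤ M) (hd : ∀ i, |d i| ≤ M) :
    opNorm (Matrix.diagonal d) ≤ M := by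
  rw [opNorm, Matrix.l2_opNorm_toEuclideanCLM, Matrix.l2_opNorm_diagonal]
  exact (pi_norm_le_iff_of_nonneg hM).2 hd

theorem opNorm_of_mul_mul_le {A : Matrix (Fin N) (Fin N) ℝ} {d : Fin N → ℝ} {M : ℝ} (hM : 0 ≤ M)
    (hd : ∀ i, |d i| ≤ M) :
    opNorm (Matrix.of fun i j => d i * A i j * d j) ≤ M ^ 2 * opNorm A := by
  have h : (Matrix.of fun i j => d i * A i j * d j) =
      Matrix.diagonal d * A * Matrix.diagonal d := by
    ext i j; simp [Matrix.diagonal_mul, Matrix.mul_diagonal]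
  have h1 := opNorm_diagonal_le hM hd
  rw [h]
  calc _ ≤ opNorm (Matrix.diagonal d) * opNorm A * opNorm (Matrix.diagonal d) :=
        (opNorm_mul_le _ _).trans (mul_le_mul_of_nonneg_right (opNorm_mul_le _ _) (opNorm_nonneg _))
    _ ≤ M * opNorm A * M := by
        have := opNorm_nonneg A
        have := opNorm_nonneg (Matrix.diagonal d)
        gcongr
    _ = _ := by ring

theorem opNorm_le_of_abs_le {A : Matrix (Fin N) (Fin N) ℝ} {m : ℝ} (hm : 0 ≤ m)
    (hA : ∀ i j, |A i j| ≤ m) : opNorm A ≤ N * m := by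
  refine ContinuousLinearMap.opNorm_le_bound _ (by positivity) fun v => ?_
  refine abs_le_of_sq_le_sq' ?_ (by positivity) |>.2
  rw [mul_pow, EuclideanSpace.real_norm_sq_eq, EuclideanSpace.real_norm_sq_eq]
  calc ∑ i, (Matrix.toEuclideanCLM (n := Fin N) (𝕜 := ℝ) A v) i ^ 2
      = ∑ i, (∑ j, A i j * v j) ^ 2 := by
        refine Finset.sum_congr rfl fun i _ => ?_
        simp [Matrix.ofLp_toEuclideanCLM, Matrix.mulVec, dotProduct]
    _ ≤ ∑ i : Fin N, (N * m ^ 2) * ∑ j, v j ^ 2 := by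
        refine Finset.sum_le_sum fun i _ => (Finset.sum_mul_sq_le_sq_mul_sq _ _ _).trans ?_
        gcongr
        calc ∑ j, A i j ^ 2 ≤ ∑ j : Fin N, m ^ 2 :=
              Finset.sum_le_sum fun j _ => sq_le_sq' (abs_le.1 (hA i j)).1 (abs_le.1 (hA i j)).2
          _ = N * m ^ 2 := by simp
    _ = (N * m) ^ 2 * ∑ j, v j ^ 2 := by simp; ring

/-- A symmetric matrix is controlled by its quadratic form, through polarization. -/
theorem opNorm_le_of_quadForm_le {A : Matrix (Fin N) (Fin N) ℝ} (hA : A.IsSymm) {M : ℝ}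
    (hM : 0 ≤ M)
    (h : ∀ u : EuclideanSpace ℝ (Fin N), ‖u‖ = 1 →
      |inner ℝ u (Matrix.toEuclideanCLM (n := Fin N) (𝕜 := ℝ) A u)| ≤ M) :
    opNorm A ≤ M := by
  set T := Matrix.toEuclideanCLM (n := Fin N) (𝕜 := ℝ) A with hT
  have hsymm : ∀ u v, inner ℝ u (T v) = inner ℝ (T u) v := by
    intro u v
    have : star T = T := by
      rw [hT, ← map_star, Matrix.star_eq_conjTranspose,
        Matrix.conjTranspose_eq_transpose_of_trivial, hA.eq]
    rw [← ContinuousLinearMap.adjoint_inner_left, ← ContinuousLinearMap.star_eq_adjoint, this]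
  have hq : ∀ u, |inner ℝ u (T u)| ≤ M * ‖u‖ ^ 2 := by
    intro u
    rcases eq_or_ne u 0 with rfl | hu
    · simp
    have hu' : 0 < ‖u‖ := norm_pos_iff.2 hu
    have := h (‖u‖⁻¹ • u) (by rw [norm_smul, norm_inv, norm_norm, inv_mul_cancel₀ hu'.ne'])
    rw [map_smul, inner_smul_left, inner_smul_right] at this
    simp only [conj_trivial, abs_mul, abs_inv, abs_norm] at this
    calc |inner ℝ u (T u)| = (‖u‖⁻¹ * (‖u‖⁻¹ * |inner ℝ u (T u)|)) * ‖u‖ ^ 2 := by field_simp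
      _ ≤ M * ‖u‖ ^ 2 := by gcongr
  refine ContinuousLinearMap.opNorm_le_bound _ hM fun v => ?_
  rcases eq_or_ne (T v) 0 with h0 | h0
  · rw [← hT, h0, norm_zero]; positivity
  have hv0 : v ≠ 0 := by rintro rfl; simp at h0
  have hTv : 0 < ‖T v‖ := norm_pos_iff.2 h0
  have hv : 0 < ‖v‖ := norm_pos_iff.2 hv0
  -- the vector of norm `‖v‖` in the direction of `T v`
  set u : EuclideanSpace ℝ (Fin N) := (‖v‖ * ‖T v‖⁻¹) • T v with hu
  have hun : ‖u‖ = ‖v‖ := by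
    rw [hu, norm_smul, Real.norm_of_nonneg (by positivity)]; field_simp
  have huT : inner ℝ u (T v) = ‖v‖ * ‖T v‖ := by
    rw [hu, inner_smul_left, real_inner_self_eq_norm_sq]; simp; field_simp
  have hpol : 4 * inner ℝ u (T v) =
      inner ℝ (u + v) (T (u + v)) - inner ℝ (u - v) (T (u - v)) := by
    simp only [map_add, map_sub, inner_add_left, inner_add_right, inner_sub_left, inner_sub_right]
    rw [hsymm v u, real_inner_comm u (T v)]; ring
  have hpar := parallelogram_law_with_norm ℝ u v
  have h1 := (abs_le.1 (hq (u + v))).2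
  have h2 := (abs_le.1 (hq (u - v))).1
  have : ‖v‖ * ‖T v‖ ≤ ‖v‖ * (M * ‖v‖) := by
    rw [← huT]; rw [hun] at hpar; nlinarith
  exact le_of_mul_le_mul_left this hv

end OpNorm

/-! ### Symmetric matrices and their quadratic forms -/

/-- The position on or above the diagonal that carries the entry `(i, j)` of a symmetric
matrix. -/
def upperIdx {N : ℕ} (i j : Fin N) : {p : Fin N × Fin N // p.1 ≤ p.2} :=
  ⟨(min i j, max i j), min_le_max⟩

theorem upperIdx_of_le {N : ℕ} {i j : Fin N} (h : i ≤ j) : upperIdx i j = ⟨(i, j), h⟩ := by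
  simp [upperIdx, h]

theorem upperIdx_comm {N : ℕ} (i j : Fin N) : upperIdx i j = upperIdx j i := by
  simp [upperIdx, min_comm, max_comm]

/-- The symmetric matrix with prescribed entries on and above the diagonal. -/
def symMatrix {N : ℕ} (b : {p : Fin N × Fin N // p.1 ≤ p.2} → ℝ) : Matrix (Fin N) (Fin N) ℝ :=
  Matrix.of fun i j => b (upperIdx i j)

theorem symMatrix_isSymm {N : ℕ} (b : {p : Fin N × Fin N // p.1 ≤ p.2} → ℝ) :
    (symMatrix b).IsSymm := by
  ext i j; simp [symMatrix, upperIdx_comm]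

/-- The coefficients of the quadratic form `u ↦ ⟨u, B u⟩`, seen as a linear function of the
entries of the symmetric matrix `B` on and above the diagonal. -/
def quadCoeff {N : ℕ} (u : EuclideanSpace ℝ (Fin N)) (p : {p : Fin N × Fin N // p.1 ≤ p.2}) : ℝ :=
  ∑ q : Fin N × Fin N with upperIdx q.1 q.2 = p, u q.1 * u q.2

theorem inner_symMatrix {N : ℕ} (b : {p : Fin N × Fin N // p.1 ≤ p.2} → ℝ)
    (u : EuclideanSpace ℝ (Fin N)) :
    inner ℝ u (Matrix.toEuclideanCLM (n := Fin N) (𝕜 := ℝ) (symMatrix b) u) =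
      ∑ p, quadCoeff u p * b p := by
  have h1 : ∀ p, quadCoeff u p * b p = ∑ q : Fin N × Fin N with upperIdx q.1 q.2 = p,
      u q.1 * u q.2 * b (upperIdx q.1 q.2) := by
    intro p
    rw [quadCoeff, Finset.sum_mul]
    refine Finset.sum_congr rfl fun q hq => ?_
    rw [(Finset.mem_filter.1 hq).2]
  rw [Finset.sum_congr rfl fun p _ => h1 p, Finset.sum_fiberwise, Fintype.sum_prod_type,
    PiLp.inner_apply]
  refine Finset.sum_congr rfl fun i _ => ?_
  simp only [Matrix.ofLp_toEuclideanCLM, Matrix.mulVec, dotProduct, symMatrix, Matrix.of_apply,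
    RCLike.inner_apply, conj_trivial, Finset.sum_mul]
  exact Finset.sum_congr rfl fun j _ => by ring

theorem sum_sq_quadCoeff_le {N : ℕ} (u : EuclideanSpace ℝ (Fin N)) :
    ∑ p, quadCoeff u p ^ 2 ≤ 2 * ‖u‖ ^ 4 := by
  have h1 : ∀ p, quadCoeff u p ^ 2 ≤
      2 * ∑ q : Fin N × Fin N with upperIdx q.1 q.2 = p, (u q.1 * u q.2) ^ 2 := by
    intro p
    refine sq_sum_le_card_mul_sum_sq.trans ?_
    gcongr
    have hsub : (Finset.univ.filter fun q : Fin N × Fin N => upperIdx q.1 q.2 = p) ⊆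
        {(p.1.1, p.1.2), (p.1.2, p.1.1)} := by
      rintro ⟨i, j⟩ hq
      have := (Finset.mem_filter.1 hq).2
      subst this
      rcases le_total i j with h | h <;> simp [upperIdx, h]
    exact_mod_cast (Finset.card_le_card hsub).trans Finset.card_le_two
  refine (Finset.sum_le_sum fun p _ => h1 p).trans_eq ?_
  rw [← Finset.mul_sum, Finset.sum_fiberwise, Fintype.sum_prod_type,
    show ‖u‖ ^ 4 = ‖u‖ ^ 2 * ‖u‖ ^ 2 by ring, EuclideanSpace.real_norm_sq_eq, Finset.sum_mul_sum]
  simp only [mul_pow]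

theorem measurable_quadCoeff {N : ℕ} (p : {p : Fin N × Fin N // p.1 ≤ p.2}) :
    Measurable fun u : EuclideanSpace ℝ (Fin N) => quadCoeff u p := by
  unfold quadCoeff
  fun_prop

/-! ### The norm of a symmetric matrix with independent sub-Gaussian entries -/

theorem hasSubgaussianMGF_mono {Ω : Type*} [MeasurableSpace Ω] {P : Measure Ω} {X : Ω → ℝ}
    {c d : NNReal} (h : HasSubgaussianMGF X c P) (hcd : c ≤ d) : HasSubgaussianMGF X d P where
  integrable_exp_mul := h.integrable_exp_mul
  mgf_le t := (h.mgf_le t).trans (by gcongr)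

theorem measureReal_quadForm_ge_le {N : ℕ} {Ω : Type*} [MeasurableSpace Ω] {P : Measure Ω}
    [IsProbabilityMeasure P] {b : {p : Fin N × Fin N // p.1 ≤ p.2} → Ω → ℝ} {v : NNReal}
    (hind : iIndepFun b P) (hsub : ∀ p, HasSubgaussianMGF (b p) v P)
    {u : EuclideanSpace ℝ (Fin N)} (hu : ‖u‖ ≤ 2) {t : ℝ} (ht : 0 ≤ t) :
    P.real {ω | t ≤ |∑ p, quadCoeff u p * b p ω|} ≤ 2 * Real.exp (-t ^ 2 / (64 * v)) := by
  have h1 : HasSubgaussianMGF (fun ω => ∑ p, quadCoeff u p * b p ω) (32 * v) P := by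
    have hi : iIndepFun (fun p ω => quadCoeff u p * b p ω) P :=
      hind.comp (fun p y => quadCoeff u p * y) fun p => by fun_prop
    refine hasSubgaussianMGF_mono (HasSubgaussianMGF.sum_of_iIndepFun hi
      (s := Finset.univ) fun p _ => (hsub p).const_mul (quadCoeff u p)) ?_
    have hsum : ∑ p, quadCoeff u p ^ 2 ≤ 32 := by
      refine (sum_sq_quadCoeff_le u).trans ?_
      have : ‖u‖ ^ 4 ≤ 2 ^ 4 := by gcongr
      linarith
    rw [← NNReal.coe_le_coe, NNReal.coe_sum, NNReal.coe_mul]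
    calc _ = (∑ p, quadCoeff u p ^ 2) * (v : ℝ) := by
          rw [Finset.sum_mul]; exact Finset.sum_congr rfl fun p _ => rfl
      _ ≤ 32 * (v : ℝ) := by gcongr
  have h2 := h1.measure_ge_le ht
  have h3 := h1.neg.measure_ge_le ht
  have hsubset : {ω | t ≤ |∑ p, quadCoeff u p * b p ω|} ⊆
      {ω | t ≤ ∑ p, quadCoeff u p * b p ω} ∪
        {ω | t ≤ (-fun ω => ∑ p, quadCoeff u p * b p ω) ω} := by
    intro ω (hω : t ≤ |∑ p, quadCoeff u p * b p ω|)
    exact le_abs.1 hω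
  refine (measureReal_mono hsubset).trans ((measureReal_union_le _ _).trans ?_)
  have he : (2 * ((32 * v : NNReal) : ℝ)) = 64 * v := by push_cast; ring
  rw [he] at h2 h3
  linarith

/-- If the operator norm exceeds `3 t`, then the quadratic form exceeds `t` on a set of
vectors whose volume is at least that of a ball of radius `1/4`. -/
theorem volume_ball_le_of_lt_opNorm {N : ℕ} {A : Matrix (Fin N) (Fin N) ℝ} (hA : A.IsSymm)
    {t : ℝ} (ht : 0 ≤ t) (h : 3 * t < opNorm A) :
    volume (Metric.ball (0 : EuclideanSpace ℝ (Fin N)) (1 / 4)) ≤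
      volume {u : EuclideanSpace ℝ (Fin N) | ‖u‖ < 2 ∧
        t ≤ |inner ℝ u (Matrix.toEuclideanCLM (n := Fin N) (𝕜 := ℝ) A u)|} := by
  by_contra hlt
  refine absurd h (not_lt.2 ?_)
  -- a unit vector `w` is within distance `1/4` of a vector at which the quadratic form is below `t`
  set T := Matrix.toEuclideanCLM (n := Fin N) (𝕜 := ℝ) A with hT
  have hTn : ‖T‖ = opNorm A := rfl
  have hnn := opNorm_nonneg A
  have key : opNorm A ≤ t + 9 / 16 * opNorm A := by
    refine opNorm_le_of_quadForm_le hA (by positivity) fun w hw => ?_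
    obtain ⟨u, hu, hut⟩ : ∃ u ∈ Metric.ball w (1 / 4), u ∉ {u : EuclideanSpace ℝ (Fin N) |
        ‖u‖ < 2 ∧ t ≤ |inner ℝ u (T u)|} := by
      by_contra! hcon
      refine hlt ?_
      rw [← Measure.addHaar_ball_center volume w]
      exact measure_mono hcon
    have hd : ‖w - u‖ < 1 / 4 := by
      rw [← dist_eq_norm, dist_comm]; exact hu
    have hun : ‖u‖ ≤ 5 / 4 := by
      have := norm_sub_norm_le u w
      rw [norm_sub_rev] at this
      linarith
    have hlt' : |inner ℝ u (T u)| < t := by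
      by_contra! hcon
      exact hut ⟨by linarith, hcon⟩
    have hdiff : inner ℝ w (T w) - inner ℝ u (T u) =
        inner ℝ (w - u) (T w) + inner ℝ u (T (w - u)) := by
      rw [map_sub, inner_sub_left, inner_sub_right]; ring
    have hb1 : |inner ℝ (w - u) (T w)| ≤ 1 / 4 * opNorm A := by
      refine (abs_real_inner_le_norm _ _).trans ?_
      have := T.le_opNorm w
      rw [hw, mul_one, hTn] at this
      gcongr
    have hb2 : |inner ℝ u (T (w - u))| ≤ 5 / 4 * (opNorm A * (1 / 4)) := by
      refine (abs_real_inner_le_norm _ _).trans ?_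
      have := T.le_opNorm (w - u)
      rw [hTn] at this
      gcongr
      exact this.trans (by gcongr)
    have : |inner ℝ w (T w)| ≤ |inner ℝ u (T u)| + |inner ℝ (w - u) (T w)| +
        |inner ℝ u (T (w - u))| := by
      rw [show inner ℝ w (T w) = inner ℝ u (T u) + (inner ℝ (w - u) (T w) +
        inner ℝ u (T (w - u))) by rw [← hdiff]; ring, add_assoc]
      exact (abs_add_le _ _).trans (add_le_add_right (abs_add_le _ _) _)
    linarith
  linarith

/-- A symmetric matrix of size `N` with independent sub-Gaussian entries has norm of order `√N`,
up to an event of exponentially small probability. By Fubini, the mean volume of the set of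
vectors with large quadratic form is small, and `volume_ball_le_of_lt_opNorm` together with
Markov's inequality concludes. This plays the role of a union bound over a net. -/
theorem measureReal_lt_opNorm_symMatrix_le {N : ℕ} {Ω : Type*} [MeasurableSpace Ω]
    {P : Measure Ω} [IsProbabilityMeasure P] {b : {p : Fin N × Fin N // p.1 ≤ p.2} → Ω → ℝ}
    {v : NNReal} (hv : 0 < v) (hb : ∀ p, Measurable (b p))
    (hind : iIndepFun b P) (hsub : ∀ p, HasSubgaussianMGF (b p) v P) :
    P.real {ω | 48 * √(v * N) < opNorm (symMatrix fun p => b p ω)} ≤ 2 * Real.exp (-N) := by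
  set t : ℝ := 16 * √(v * N) with ht
  have ht0 : 0 ≤ t := by positivity
  set S : Set (Ω × EuclideanSpace ℝ (Fin N)) :=
    {z | ‖z.2‖ < 2 ∧ t ≤ |∑ p, quadCoeff z.2 p * b p z.1|} with hS
  have hSm : MeasurableSet S := by
    have h1 : Measurable fun z : Ω × EuclideanSpace ℝ (Fin N) => ‖z.2‖ := by fun_prop
    have h2 : Measurable fun z : Ω × EuclideanSpace ℝ (Fin N) =>
        |∑ p, quadCoeff z.2 p * b p z.1| :=
      Measurable.abs (Finset.measurable_sum _ fun p _ =>
        ((measurable_quadCoeff p).comp measurable_snd).mul ((hb p).comp measurable_fst))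
    exact (measurableSet_lt h1 measurable_const).inter (measurableSet_le measurable_const h2)
  set B := volume (Metric.ball (0 : EuclideanSpace ℝ (Fin N)) (1 / 4)) with hB
  have hB0 : B ≠ 0 := (Metric.measure_ball_pos _ _ (by norm_num)).ne'
  have hBt : B ≠ ⊤ := measure_ball_lt_top.ne
  have hexp : -t ^ 2 / (64 * v) = -(4 * N) := by
    have : (v : ℝ) ≠ 0 := by exact_mod_cast hv.ne'
    rw [ht, mul_pow, Real.sq_sqrt (by positivity)]
    field_simp
    ring
  have hfub : ∫⁻ ω, volume (Prod.mk ω ⁻¹' S) ∂P ≤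
      ENNReal.ofReal (2 * Real.exp (-(4 * N))) * (ENNReal.ofReal (8 ^ N) * B) := by
    rw [← Measure.prod_apply hSm, Measure.prod_apply_symm hSm]
    have hball : volume (Metric.ball (0 : EuclideanSpace ℝ (Fin N)) 2) =
        ENNReal.ofReal (8 ^ N) * B := by
      rw [show (2 : ℝ) = 8 * (1 / 4) by norm_num,
        Measure.addHaar_ball_mul_of_pos _ _ (by norm_num)]
      simp [hB]
    rw [← hball, ← setLIntegral_const, ← lintegral_indicator Metric.isOpen_ball.measurableSet]
    refine lintegral_mono fun u => ?_
    by_cases hu : u ∈ Metric.ball (0 : EuclideanSpace ℝ (Fin N)) 2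
    · rw [Set.indicator_of_mem hu]
      have hu' : ‖u‖ < 2 := by simpa using hu
      have h := measureReal_quadForm_ge_le hind hsub hu'.le ht0
      rw [hexp] at h
      refine (measure_mono (t := {ω | t ≤ |∑ p, quadCoeff u p * b p ω|}) fun ω hω => hω.2).trans ?_
      rw [← ofReal_measureReal]
      exact ENNReal.ofReal_le_ofReal h
    · rw [Set.indicator_of_notMem hu]
      have : (fun ω => (ω, u)) ⁻¹' S = ∅ := by
        ext ω
        simp only [Set.mem_preimage, hS, Set.mem_ofPred_eq, Set.mem_empty_iff_false, iff_false]
        intro h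
        exact hu (by simpa using h.1)
      simp [this]
  have hmarkov :=
    mul_meas_ge_le_lintegral (μ := P) (measurable_measure_prodMk_left (ν := volume) hSm) B
  have hle : P {ω | B ≤ volume (Prod.mk ω ⁻¹' S)} ≤
      ENNReal.ofReal (2 * Real.exp (-(4 * N)) * 8 ^ N) := by
    have := hmarkov.trans hfub
    rw [← mul_assoc, ← ENNReal.ofReal_mul (by positivity), mul_comm B] at this
    exact (ENNReal.mul_le_mul_iff_left hB0 hBt).1 this
  have hsubset : {ω | 48 * √(v * N) < opNorm (symMatrix fun p => b p ω)} ⊆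
      {ω | B ≤ volume (Prod.mk ω ⁻¹' S)} := by
    intro ω (hω : 48 * √(v * N) < opNorm (symMatrix fun p => b p ω))
    have h3 : 3 * t < opNorm (symMatrix fun p => b p ω) := by
      rw [ht, ← mul_assoc, show (3 : ℝ) * 16 = 48 by norm_num]
      exact hω
    have := volume_ball_le_of_lt_opNorm (symMatrix_isSymm _) ht0 h3
    simp only [inner_symMatrix] at this
    exact this
  have hfin : 2 * Real.exp (-(4 * N)) * 8 ^ N ≤ 2 * Real.exp (-N) := by
    have h8 : (8 : ℝ) ≤ Real.exp 3 := by
      have := Real.exp_one_gt_d9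
      rw [show (3 : ℝ) = 1 + 1 + 1 by norm_num, Real.exp_add, Real.exp_add]
      nlinarith [mul_self_nonneg (Real.exp 1 - 2)]
    have : (8 : ℝ) ^ N ≤ Real.exp (3 * N) := by
      rw [mul_comm, Real.exp_nat_mul]; gcongr
    calc 2 * Real.exp (-(4 * N)) * 8 ^ N ≤ 2 * Real.exp (-(4 * N)) * Real.exp (3 * N) := by gcongr
      _ = 2 * Real.exp (-N) := by rw [mul_assoc, ← Real.exp_add]; ring_nf
  exact (ENNReal.toReal_le_of_le_ofReal (by positivity)
    ((measure_mono hsubset).trans hle)).trans hfin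

/-! ### Consequences of stretched exponential tails -/

theorem one_le_one_add_log {N : ℕ} (hN : 1 ≤ N) : 1 ≤ 1 + Real.log N := by
  linarith [Real.log_nonneg (Nat.one_le_cast.2 hN : (1 : ℝ) ≤ N)]

/-- Laws with stretched exponential tails live on a logarithmic scale: the probability to exceed
a large multiple of `(1 + log N)^⌈1/α⌉` decays faster than any prescribed power of `N`. -/
theorem HasStretchedExpTails.exists_measureReal_le {ρ : Measure ℝ} {α : ℝ}
    (h : HasStretchedExpTails ρ α) (s : ℕ) :
    ∃ κ C : ℝ, 0 < κ ∧ 0 ≤ C ∧ ∀ N : ℕ, 1 ≤ N →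
      ρ.real {x | κ * (1 + Real.log N) ^ ⌈1 / α⌉₊ < |x|} ≤ C / (N : ℝ) ^ s := by
  obtain ⟨hα, C, c, hC, hc, htail⟩ := h
  set κ : ℝ := ((s + 1) / c) ^ (1 / α) with hκ
  have hκ0 : 0 < κ := by positivity
  refine ⟨κ, C, hκ0, hC.le, fun N hN => ?_⟩
  have hl := one_le_one_add_log hN
  have hN0 : (0 : ℝ) < N := by exact_mod_cast hN
  refine (htail _ (by positivity)).trans ?_
  rw [div_eq_mul_inv]
  refine mul_le_mul_of_nonneg_left ?_ hC.le
  have h1 : κ ^ α = (s + 1) / c := by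
    rw [hκ, ← Real.rpow_mul (by positivity), one_div_mul_cancel hα.ne', Real.rpow_one]
  have h2 : 1 + Real.log N ≤ ((1 + Real.log N) ^ ⌈1 / α⌉₊) ^ α := by
    rw [← Real.rpow_natCast, ← Real.rpow_mul (by linarith)]
    refine Real.self_le_rpow_of_one_le hl ?_
    calc (1 : ℝ) = 1 / α * α := (one_div_mul_cancel hα.ne').symm
      _ ≤ ⌈1 / α⌉₊ * α := by gcongr; exact Nat.le_ceil _
  rw [Real.mul_rpow hκ0.le (by positivity), h1]
  calc Real.exp (-(c * ((s + 1) / c * ((1 + Real.log N) ^ ⌈1 / α⌉₊) ^ α)))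
      ≤ Real.exp (-(s * Real.log N)) := by
        rw [Real.exp_le_exp, neg_le_neg_iff, ← mul_assoc, mul_div_cancel₀ _ hc.ne']
        have hlog : 0 ≤ Real.log N := by linarith
        calc (s : ℝ) * Real.log N ≤ (s + 1) * (1 + Real.log N) := by nlinarith
          _ ≤ _ := by gcongr
    _ = ((N : ℝ) ^ s)⁻¹ := by
        rw [Real.exp_neg, mul_comm, Real.exp_mul, Real.exp_log hN0, Real.rpow_natCast]

/-- Laws with stretched exponential tails have moments of all orders. -/
theorem HasStretchedExpTails.integrable_pow {ρ : Measure ℝ} [IsProbabilityMeasure ρ] {α : ℝ}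
    (h : HasStretchedExpTails ρ α) (n : ℕ) : Integrable (fun x : ℝ => x ^ n) ρ := by
  obtain ⟨hα, C, c, hC, hc, htail⟩ := h
  refine ⟨by fun_prop, ?_⟩
  -- the tail at integers decays like `m ^ (-(n + 2))`, so `∑ m ^ n P(m < |x|)` converges
  obtain ⟨K, hK0, hK⟩ : ∃ K : ℝ, 0 ≤ K ∧ ∀ m : ℕ, 1 ≤ m →
      ρ.real {x | (m : ℝ) < |x|} ≤ K / (m : ℝ) ^ (n + 2) := by
    set j := ⌈((n + 2 : ℕ) : ℝ) / α⌉₊ with hj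
    refine ⟨C * (j.factorial / c ^ j), by positivity, fun m hm => ?_⟩
    have hm0 : (0 : ℝ) < m := by exact_mod_cast hm
    refine (htail m hm0).trans ?_
    rw [mul_div_assoc]
    gcongr
    have h1 : (m : ℝ) ^ (n + 2) ≤ ((m : ℝ) ^ α) ^ j := by
      rw [← Real.rpow_natCast, ← Real.rpow_natCast, ← Real.rpow_mul hm0.le]
      refine Real.rpow_le_rpow_of_exponent_le (by exact_mod_cast hm) ?_
      rw [mul_comm, ← div_le_iff₀ hα]
      exact Nat.le_ceil _
    have h2 := Real.pow_div_factorial_le_exp (c * (m : ℝ) ^ α) (by positivity) j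
    rw [Real.exp_neg, inv_le_comm₀ (Real.exp_pos _) (by positivity)]
    refine le_trans ?_ h2
    rw [mul_pow, inv_div, div_div_eq_mul_div, mul_comm]
    gcongr
  have hpt : ∀ x : ℝ, ‖x ^ n‖ₑ ≤ 1 + ∑' m : ℕ,
      Set.indicator {x : ℝ | ((m + 1 : ℕ) : ℝ) < |x|}
        (fun _ => ENNReal.ofReal (((m + 2 : ℕ) : ℝ) ^ n)) x := by
    intro x
    rw [← ofReal_norm, norm_pow, Real.norm_eq_abs]
    rcases le_or_gt |x| 1 with hx | hx
    · refine le_add_right ?_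
      rw [← ENNReal.ofReal_one]
      exact ENNReal.ofReal_le_ofReal (pow_le_one₀ (abs_nonneg _) hx)
    · obtain ⟨m, hm⟩ : ∃ m : ℕ, ⌈|x|⌉₊ = m + 2 := by
        have : 1 < ⌈|x|⌉₊ := Nat.lt_ceil.2 (by exact_mod_cast hx)
        exact ⟨⌈|x|⌉₊ - 2, by omega⟩
      refine le_trans ?_ (le_add_left (ENNReal.le_tsum m))
      rw [Set.indicator_of_mem]
      · refine ENNReal.ofReal_le_ofReal ?_
        gcongr
        rw [← hm]; exact Nat.le_ceil _
      · have : m + 1 < ⌈|x|⌉₊ := by omega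
        exact Nat.lt_ceil.1 this
  refine (lintegral_mono hpt).trans_lt ?_
  have hms : ∀ m : ℕ, MeasurableSet {x : ℝ | ((m + 1 : ℕ) : ℝ) < |x|} := fun m =>
    measurableSet_lt measurable_const (by fun_prop)
  rw [lintegral_add_left measurable_const, lintegral_tsum fun m =>
    (measurable_const.indicator (hms m)).aemeasurable]
  refine ENNReal.add_lt_top.2 ⟨by simp, ?_⟩
  have hsum : Summable fun m : ℕ => K * 2 ^ n * (1 / ((m + 1 : ℕ) : ℝ) ^ 2) :=
    ((summable_nat_add_iff 1).2 (Real.summable_one_div_nat_pow.2 one_lt_two)).mul_left _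
  refine (ENNReal.tsum_le_tsum fun m => ?_).trans_lt hsum.tsum_ofReal_lt_top
  rw [lintegral_indicator (hms m), setLIntegral_const, ← ofReal_measureReal,
    ← ENNReal.ofReal_mul (by positivity)]
  refine ENNReal.ofReal_le_ofReal ?_
  have hm1 : (0 : ℝ) < ((m + 1 : ℕ) : ℝ) := by positivity
  calc ((m + 2 : ℕ) : ℝ) ^ n * ρ.real {x | ((m + 1 : ℕ) : ℝ) < |x|}
      ≤ (2 * ((m + 1 : ℕ) : ℝ)) ^ n * (K / ((m + 1 : ℕ) : ℝ) ^ (n + 2)) := by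
        gcongr
        · push_cast; linarith
        · exact hK (m + 1) (by omega)
    _ = K * 2 ^ n * (1 / ((m + 1 : ℕ) : ℝ) ^ 2) := by
        rw [mul_pow, pow_add]; field_simp

/-! ### The norm of a centered random matrix -/

/-- A symmetric matrix whose entries are iid, centered, and polynomials in variables with stretched
exponential tails has norm at most `√N` up to a power of `log N`, with high probability. The
entries are truncated at a logarithmic scale, and the truncated entries are sub-Gaussian by
Hoeffding's lemma. -/
theorem exists_measureReal_opNorm_symMatrix_le {μ : Measure ℝ} [IsProbabilityMeasure μ] {α : ℝ}
    (hμ : HasStretchedExpTails μ α) {h : ℝ → ℝ} (hm : Measurable h) {D : ℝ} (hD : 0 ≤ D) {n : ℕ}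
    (hgrow : ∀ z, |h z| ≤ D * (1 + |z|) ^ n) (hL2 : MemLp h 2 μ) (hmean : ∫ z, h z ∂μ = 0) :
    ∃ K : ℝ, 0 < K ∧ ∀ (N : ℕ) (Ω : Type) [MeasurableSpace Ω] (P : Measure Ω)
      [IsProbabilityMeasure P] (ζ : {p : Fin N × Fin N // p.1 ≤ p.2} → Ω → ℝ), 1 ≤ N →
      (∀ p, Measurable (ζ p)) → (∀ p, HasLaw (ζ p) μ P) → iIndepFun ζ P →
      P.real {ω | K * √N * (1 + Real.log N) ^ (⌈1 / α⌉₊ * n) <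
        opNorm (symMatrix fun p => h (ζ p ω))} ≤ K / N := by
  obtain ⟨κ, C, hκ, hC, htail⟩ := hμ.exists_measureReal_le 4
  set H : ℝ := ∫ z, h z ^ 2 ∂μ with hH
  have hH0 : 0 ≤ H := integral_nonneg fun z => sq_nonneg _
  set D' : ℝ := D + 1 with hD'
  refine ⟨48 * (D' * (1 + κ) ^ n) + H + C + 2, by positivity, ?_⟩
  intro N Ω _ P _ ζ hN hζm hζl hζi
  have hl := one_le_one_add_log hN
  have hN0 : (0 : ℝ) < N := by exact_mod_cast hN
  have hN1 : (1 : ℝ) ≤ N := by exact_mod_cast hN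
  set lam : ℝ := 1 + Real.log N with hlam
  set M : ℝ := κ * lam ^ ⌈1 / α⌉₊ with hM
  have hM0 : 0 < M := by positivity
  set T : Set ℝ := {z | M < |z|} with hT
  have hTm : MeasurableSet T := measurableSet_lt measurable_const (by fun_prop)
  have hTle : μ.real T ≤ C / (N : ℝ) ^ 4 := htail N hN
  set L : ℝ := D' * (1 + M) ^ n with hL
  have hL0 : 0 < L := by positivity
  set g : ℝ → ℝ := Tᶜ.indicator h with hg
  have hgm : Measurable g := hm.indicator hTm.compl
  have hgL : ∀ z, |g z| ≤ L := by
    intro z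
    by_cases hz : z ∈ T
    · rw [hg, Set.indicator_of_notMem (by simpa using hz)]; simpa using hL0.le
    · rw [hg, Set.indicator_of_mem (by simpa using hz)]
      have hz' : |z| ≤ M := not_lt.1 hz
      refine (hgrow z).trans ?_
      rw [hL]
      gcongr
      linarith
  set m : ℝ := ∫ z, g z ∂μ with hmdef
  -- the truncation shifts the mean by an amount that is negligible even after multiplication by `N`
  have hm_le : N * |m| ≤ (H + C) * √N := by
    have hgint : Integrable g μ := (hL2.integrable one_le_two).indicator hTm.compl
    have hsq := (hL2.integrable_sq).div_const √N
    have hind : Integrable (fun z => √N * T.indicator (1 : ℝ → ℝ) z) μ :=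
      ((integrable_const (1 : ℝ)).indicator hTm).const_mul _
    have h1 : m = -∫ z, T.indicator h z ∂μ := by
      have := integral_add (μ := μ) hgint ((hL2.integrable one_le_two).indicator hTm)
      rw [show (fun z => g z + T.indicator h z) = h by
        funext z; simp [hg], hmean] at this
      linarith
    have h2 : |m| ≤ ∫ z, (h z ^ 2 / √N + √N * T.indicator 1 z) ∂μ := by
      rw [h1, abs_neg]
      refine (abs_integral_le_integral_abs).trans
        (integral_mono_of_nonneg (ae_of_all _ fun z => abs_nonneg _) ?_ (ae_of_all _ fun z => ?_))
      · exact hsq.add hind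
      · by_cases hz : z ∈ T
        · simp only [Set.indicator_of_mem hz, Pi.one_apply, mul_one]
          have hs : 0 < √(N : ℝ) := Real.sqrt_pos.2 hN0
          rw [div_add' _ _ _ hs.ne', le_div_iff₀ hs]
          nlinarith [sq_nonneg (|h z| - √N), sq_abs (h z), abs_nonneg (h z)]
        · simp only [Set.indicator_of_notMem hz, abs_zero, mul_zero, add_zero]
          positivity
    rw [integral_add hsq hind, integral_div, integral_const_mul, integral_indicator_one hTm] at h2
    calc N * |m| ≤ N * (H / √N + √N * (C / (N : ℝ) ^ 4)) := by
          gcongr; exact h2.trans (by gcongr)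
      _ = H * √N + C * √N * (N / (N : ℝ) ^ 4) := by
          rw [show N * (H / √N + √N * (C / (N : ℝ) ^ 4)) =
            H * (N / √N) + C * √N * (N / (N : ℝ) ^ 4) by ring, Real.div_sqrt]
      _ ≤ H * √N + C * √N * 1 := by
          gcongr
          rw [div_le_one (by positivity)]
          exact le_self_pow₀ hN1 (by norm_num)
      _ = _ := by ring
  set b : {p : Fin N × Fin N // p.1 ≤ p.2} → Ω → ℝ := fun p ω => g (ζ p ω) - m with hb
  set v : NNReal := (‖L - -L‖₊ / 2) ^ 2 with hv
  have hvL : (v : ℝ) = L ^ 2 := by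
    rw [hv]; push_cast; rw [Real.norm_of_nonneg (by linarith)]; ring
  have hsub : ∀ p, HasSubgaussianMGF (b p) v P := by
    intro p
    have := hasSubgaussianMGF_of_mem_Icc (μ := P) (X := fun ω => g (ζ p ω)) (a := -L) (b := L)
      (hgm.comp (hζm p)).aemeasurable (ae_of_all _ fun ω => abs_le.1 (hgL _))
    rwa [show P[fun ω => g (ζ p ω)] = m from
      (hζl p).integral_comp (f := g) hgm.aestronglyMeasurable] at this
  have hind : iIndepFun b P := hζi.comp (fun _ z => g z - m) fun _ => hgm.sub_const _
  have hprob := measureReal_lt_opNorm_symMatrix_le (P := P) (b := b) (v := v)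
    (by rw [← NNReal.coe_pos, hvL]; positivity) (fun p => (hgm.comp (hζm p)).sub_const _) hind hsub
  rw [hvL, Real.sqrt_mul (sq_nonneg L), Real.sqrt_sq hL0.le] at hprob
  have hbad : P.real (⋃ p, ζ p ⁻¹' T) ≤ C / N := by
    refine (measureReal_iUnion_fintype_le _).trans ?_
    have h1 : ∀ p, P.real (ζ p ⁻¹' T) ≤ C / (N : ℝ) ^ 4 := by
      intro p
      have := (hζl p).measureReal_eq (p := fun z => M < |z|) hTm
      exact this.trans_le hTle
    refine (Finset.sum_le_sum fun p _ => h1 p).trans ?_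
    rw [Finset.sum_const, nsmul_eq_mul]
    have hcard : ((Finset.univ : Finset {p : Fin N × Fin N // p.1 ≤ p.2}).card : ℝ) ≤ N ^ 2 := by
      have := Fintype.card_subtype_le fun p : Fin N × Fin N => p.1 ≤ p.2
      rw [Fintype.card_prod, Fintype.card_fin] at this
      rw [Finset.card_univ, sq]
      exact_mod_cast this
    calc _ ≤ (N : ℝ) ^ 2 * (C / (N : ℝ) ^ 4) := by gcongr
      _ = C / N / N := by field_simp
      _ ≤ C / N := div_le_self (by positivity) hN1
  have hsubset : {ω | (48 * (D' * (1 + κ) ^ n) + H + C + 2) * √N * lam ^ (⌈1 / α⌉₊ * n) <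
        opNorm (symMatrix fun p => h (ζ p ω))} ⊆
      {ω | 48 * (L * √N) < opNorm (symMatrix fun p => b p ω)} ∪ ⋃ p, ζ p ⁻¹' T := by
    intro ω (hω : _ < opNorm _)
    by_contra hcon
    rw [Set.mem_union, not_or, Set.mem_iUnion, not_exists] at hcon
    obtain ⟨h1, h2⟩ := hcon
    have h1' : opNorm (symMatrix fun p => b p ω) ≤ 48 * (L * √N) := not_lt.1 h1
    refine absurd hω (not_lt.2 ?_)
    have heq : symMatrix (fun p => h (ζ p ω)) =
        symMatrix (fun p => b p ω) + Matrix.of fun _ _ : Fin N => m := by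
      ext i j
      have : g (ζ (upperIdx i j) ω) = h (ζ (upperIdx i j) ω) :=
        Set.indicator_of_mem (s := Tᶜ) (h2 _) _
      simp [symMatrix, hb, this]
    rw [heq]
    have hLle : L ≤ D' * (1 + κ) ^ n * lam ^ (⌈1 / α⌉₊ * n) := by
      rw [hL, mul_assoc, pow_mul, ← mul_pow]
      gcongr
      have : 1 ≤ lam ^ ⌈1 / α⌉₊ := one_le_pow₀ hl
      rw [hM]; linarith
    have hpow : 1 ≤ lam ^ (⌈1 / α⌉₊ * n) := one_le_pow₀ hl
    calc opNorm (symMatrix (fun p => b p ω) + Matrix.of fun _ _ : Fin N => m)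
        ≤ 48 * (L * √N) + N * |m| := (opNorm_add_le _ _).trans
          (add_le_add h1' (opNorm_le_of_abs_le (abs_nonneg m) fun _ _ => le_rfl))
      _ ≤ 48 * (D' * (1 + κ) ^ n * lam ^ (⌈1 / α⌉₊ * n) * √N) +
          (H + C) * √N * lam ^ (⌈1 / α⌉₊ * n) := by
          refine add_le_add (by gcongr) ?_
          exact hm_le.trans (le_mul_of_one_le_right (by positivity) hpow)
      _ ≤ (48 * (D' * (1 + κ) ^ n) + H + C + 2) * √N * lam ^ (⌈1 / α⌉₊ * n) := by
          have : 0 ≤ 2 * √N * lam ^ (⌈1 / α⌉₊ * n) := by positivity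
          linarith
  have hexp : Real.exp (-N) ≤ 1 / N := by
    rw [Real.exp_neg, ← one_div]
    exact one_div_le_one_div_of_le hN0 (by linarith [Real.add_one_le_exp (N : ℝ)])
  calc _ ≤ _ := measureReal_mono hsubset
    _ ≤ _ := measureReal_union_le _ _
    _ ≤ 2 * (1 / N) + C / N := by
        refine add_le_add (hprob.trans (by gcongr)) hbad
    _ = (C + 2) / N := by ring
    _ ≤ _ := by
        gcongr
        have : 0 ≤ 48 * (D' * (1 + κ) ^ n) + H := by positivity
        linarith

/-! ### Powers of the logarithm -/

theorem tendsto_eval_log_mul_rpow_neg (Q : Polynomial ℝ) {s : ℝ} (hs : 0 < s) :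
    Tendsto (fun N : ℕ => Q.eval (Real.log N) * (N : ℝ) ^ (-s)) atTop (𝓝 0) := by
  have hmon : ∀ n : ℕ, Tendsto (fun N : ℕ => Real.log N ^ n * (N : ℝ) ^ (-s)) atTop (𝓝 0) := by
    intro n
    have h := (isLittleO_log_rpow_rpow_atTop (n : ℝ) hs).tendsto_div_nhds_zero.comp
      tendsto_natCast_atTop_atTop
    refine h.congr fun N => ?_
    simp only [Function.comp_apply, Real.rpow_natCast]
    rw [Real.rpow_neg (Nat.cast_nonneg N), div_eq_mul_inv]
  simp only [Polynomial.eval_eq_sum_range, Finset.sum_mul, mul_assoc]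
  simpa using tendsto_finsetSum (Finset.range (Q.natDegree + 1)) fun n _ =>
    (hmon n).const_mul (Q.coeff n)

theorem relevantSNR_div_sqrt {k N : ℕ} (hN : 1 ≤ N) (γ₀ : ℝ) :
    relevantSNR k γ₀ N / √(N : ℝ) = γ₀ * (N : ℝ) ^ (-(1 / (2 * (k : ℝ)))) := by
  have hN0 : (0 : ℝ) < N := by exact_mod_cast hN
  rw [relevantSNR, Real.sqrt_eq_rpow, mul_div_assoc, ← Real.rpow_sub hN0]
  congr 2
  rw [mul_comm (2 : ℝ), ← div_div]
  ring

theorem relevantSNR_pow {k N : ℕ} (hk : 1 ≤ k) (γ₀ : ℝ) :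
    relevantSNR k γ₀ N ^ k = γ₀ ^ k * (N : ℝ) ^ ((k : ℝ) / 2 - 1 / 2) := by
  have hk0 : (k : ℝ) ≠ 0 := by positivity
  rw [relevantSNR, mul_pow, ← Real.rpow_mul_natCast (Nat.cast_nonneg N)]
  congr 2
  field_simp

theorem isAdmissibleSNR_relevantSNR {k : ℕ} (hk : 1 ≤ k) (γ₀ : ℝ) :
    IsAdmissibleSNR k (relevantSNR k γ₀) := by
  intro Q
  have hk0 : (0 : ℝ) < k := by positivity
  have h := (tendsto_eval_log_mul_rpow_neg Q (s := 1 / (2 * (k : ℝ))) (by positivity)).mul_const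
    (|γ₀| ^ (k + 1))
  rw [zero_mul] at h
  refine h.congr' ?_
  filter_upwards [eventually_ge_atTop 1] with N hN
  have hN0 : (0 : ℝ) < N := by exact_mod_cast hN
  rw [relevantSNR, abs_mul, abs_of_nonneg (Real.rpow_nonneg hN0.le _), mul_pow,
    ← Real.rpow_mul_natCast hN0.le, mul_div_assoc, mul_div_assoc, ← Real.rpow_sub hN0]
  have : (1 - 1 / (k : ℝ)) / 2 * ((k + 1 : ℕ) : ℝ) - k / 2 = -(1 / (2 * (k : ℝ))) := by
    push_cast; field_simp; ring
  rw [this]; ring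

/-! ### The spectrum of the spike -/

theorem mem_spectrum_iff_exists_mulVec {N : ℕ} {A : Matrix (Fin N) (Fin N) ℝ} {l : ℝ} :
    l ∈ spectrum ℝ A ↔ ∃ w, w ≠ 0 ∧ A.mulVec w = l • w := by
  rw [spectrum.mem_iff, Matrix.isUnit_iff_isUnit_det, isUnit_iff_ne_zero, not_not,
    ← Matrix.exists_mulVec_eq_zero_iff]
  refine exists_congr fun w => and_congr_right fun _ => ?_
  rw [Matrix.sub_mulVec, sub_eq_zero, Algebra.algebraMap_eq_smul_one, Matrix.smul_mulVec,
    Matrix.one_mulVec, eq_comm]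

/-- Away from zero, the spectrum of `c v vᵀ` is `{c |v|²}`. -/
theorem spectrum_smul_vecMulVec_diff_zero {N : ℕ} (c : ℝ) (v : Fin N → ℝ) :
    spectrum ℝ (c • Matrix.vecMulVec v v) \ {0} = {c * v ⬝ᵥ v} \ {0} := by
  ext l
  simp only [Set.mem_sdiff, Set.mem_singleton_iff, mem_spectrum_iff_exists_mulVec,
    and_congr_left_iff]
  intro hl
  have hmul : ∀ w : Fin N → ℝ, (c • Matrix.vecMulVec v v).mulVec w = (c * v ⬝ᵥ w) • v := by
    intro w
    rw [Matrix.smul_mulVec, Matrix.vecMulVec_mulVec]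
    ext i; simp; ring
  constructor
  · rintro ⟨w, hw, h⟩
    rw [hmul] at h
    have hvw : v ⬝ᵥ w ≠ 0 := by
      intro h0
      rw [h0, mul_zero, zero_smul, eq_comm, smul_eq_zero] at h
      exact h.elim hl hw
    have := congrArg (fun y => v ⬝ᵥ y) h
    simp only [dotProduct_smul, smul_eq_mul] at this
    exact mul_right_cancel₀ hvw (by linarith)
  · rintro rfl
    refine ⟨v, ?_, hmul v⟩
    rintro rfl
    simp at hl

/-- The eigenvalue of the spike that is possibly non-zero, as a multiple of the empirical moment of
order `2k` of the signal. -/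
noncomputable def spikeEigenvalue {N : ℕ} (k : ℕ) (θ γ : ℝ) (x : Fin N → ℝ) : ℝ :=
  γ ^ k / (N : ℝ) ^ ((k : ℝ) / 2 - 1 / 2) * (θ / (k.factorial : ℝ)) *
    ((∑ i, x i ^ (2 * k)) / N)

theorem spectrum_spikeMatrix_diff_zero {N : ℕ} (k : ℕ) (θ γ : ℝ) (x : Fin N → ℝ) :
    spectrum ℝ (spikeMatrix k θ γ x) \ {0} = {spikeEigenvalue k θ γ x} \ {0} := by
  rw [spikeMatrix, spectrum_smul_vecMulVec_diff_zero, spikeEigenvalue]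
  congr 3
  rw [dotProduct, Finset.sum_div]
  refine Finset.sum_congr rfl fun i _ => ?_
  rw [div_mul_div_comm, Real.mul_self_sqrt (Nat.cast_nonneg N)]
  ring

theorem exists_spectrum_spikeMatrix_iff {N : ℕ} {k : ℕ} {θ γ : ℝ} {x : Fin N → ℝ} {a b : ℝ}
    (ha : 0 < a) :
    (∃ l : ℝ, spectrum ℝ (spikeMatrix k θ γ x) \ {0} = {l} ∧ a ≤ |l| ∧ |l| ≤ b) ↔
      a ≤ |spikeEigenvalue k θ γ x| ∧ |spikeEigenvalue k θ γ x| ≤ b := by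
  rw [spectrum_spikeMatrix_diff_zero]
  constructor
  · rintro ⟨l, hl, h⟩
    have : l ∈ ({spikeEigenvalue k θ γ x} \ {0} : Set ℝ) := by rw [hl]; rfl
    rwa [← show l = spikeEigenvalue k θ γ x from this.1]
  · intro h
    refine ⟨_, ?_, h⟩
    have hne : spikeEigenvalue k θ γ x ≠ 0 := by
      intro h0
      rw [h0, abs_zero] at h
      linarith
    exact sdiff_eq_left.2 (by simpa using hne)

/-- The eigenvalue of the spike in terms of the ratio of `γ` to the relevant scaling. -/
theorem abs_spikeEigenvalue {N : ℕ} {k : ℕ} (hk : 1 ≤ k) (θ γ : ℝ) (x : Fin N → ℝ) :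
    |spikeEigenvalue k θ γ x| = (|γ| / |relevantSNR k 1 N|) ^ k * (|θ| / (k.factorial : ℝ)) *
      ((∑ i, x i ^ (2 * k)) / N) := by
  have hS : 0 ≤ (∑ i, x i ^ (2 * k)) / (N : ℝ) :=
    div_nonneg (Finset.sum_nonneg fun i _ => by rw [pow_mul]; positivity) (Nat.cast_nonneg N)
  rw [spikeEigenvalue, abs_mul, abs_mul, abs_div, abs_div, div_pow, ← abs_pow, ← abs_pow,
    relevantSNR_pow hk, one_pow, one_mul, abs_of_nonneg hS, Nat.abs_cast]

/-! ### Concentration of the spike -/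

theorem integral_pow_pos_of_ne_dirac {ρ : Measure ℝ} [IsProbabilityMeasure ρ] {α : ℝ}
    (h : HasStretchedExpTails ρ α) (hρ : ρ ≠ Measure.dirac 0) (k : ℕ) :
    0 < ∫ x, x ^ (2 * k) ∂ρ := by
  have hnn : ∀ x : ℝ, 0 ≤ x ^ (2 * k) := fun x => by rw [pow_mul]; positivity
  rw [integral_pos_iff_support_of_nonneg hnn (h.integrable_pow _), pos_iff_ne_zero]
  intro h0
  refine hρ ?_
  have hae : (id : ℝ → ℝ) =ᵐ[ρ] fun _ => (0 : ℝ) := by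
    rw [Filter.EventuallyEq, ae_iff]
    refine measure_mono_null (fun x hx => ?_) h0
    exact pow_ne_zero _ hx
  rw [← Measure.map_id (μ := ρ), Measure.map_congr hae, Measure.map_const, measure_univ, one_smul]

/-- The empirical moments of the signal concentrate, by Chebyshev's inequality. -/
theorem exists_measureReal_empirical_moment_le {ρ : Measure ℝ} [IsProbabilityMeasure ρ] {α : ℝ}
    (h : HasStretchedExpTails ρ α) (hρ : ρ ≠ Measure.dirac 0) (k : ℕ) {Ω : ℕ → Type*}
    [∀ N, MeasurableSpace (Ω N)] {P : ∀ N, Measure (Ω N)} [∀ N, IsProbabilityMeasure (P N)]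
    {x : ∀ N, Ω N → Fin N → ℝ} (hx : ∀ N i, HasLaw (fun ω => x N ω i) ρ (P N))
    (hi : ∀ N, iIndepFun (fun (i : Fin N) ω => x N ω i) (P N)) :
    ∃ m C : ℝ, 0 < m ∧ 0 ≤ C ∧ ∀ N, 1 ≤ N →
      (P N).real {ω | ¬ (m / 2 ≤ (∑ i, x N ω i ^ (2 * k)) / N ∧
        (∑ i, x N ω i ^ (2 * k)) / N ≤ 3 / 2 * m)} ≤ C / N := by
  set m := ∫ y, y ^ (2 * k) ∂ρ with hm
  have hm0 : 0 < m := integral_pow_pos_of_ne_dirac h hρ k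
  set V := Var[fun y : ℝ => y ^ (2 * k); ρ] with hV
  have hV0 : 0 ≤ V := variance_nonneg _ _
  refine ⟨m, V / (m / 2) ^ 2, hm0, by positivity, fun N hN => ?_⟩
  have hN0 : (0 : ℝ) < N := by exact_mod_cast hN
  have hpm : AEStronglyMeasurable (fun y : ℝ => y ^ (2 * k)) ρ := by fun_prop
  have hL2 : MemLp (fun y : ℝ => y ^ (2 * k)) 2 ρ := by
    rw [memLp_two_iff_integrable_sq hpm]
    simpa only [← pow_mul] using h.integrable_pow (2 * k * 2)
  have hlaw : ∀ i, HasLaw (fun ω => x N ω i ^ (2 * k)) (ρ.map fun y => y ^ (2 * k)) (P N) :=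
    fun i => HasLaw.fun_comp (Y := fun y : ℝ => y ^ (2 * k)) ⟨hpm.aemeasurable, rfl⟩ (hx N i)
  have hxL2 : ∀ i, MemLp (fun ω => x N ω i ^ (2 * k)) 2 (P N) := by
    intro i
    have hxm := (hx N i).aemeasurable
    have := hL2
    rw [← (hx N i).map_eq] at this
    exact this.comp_of_map hxm
  have hE : ∀ i, ∫ ω, x N ω i ^ (2 * k) ∂(P N) = m := fun i =>
    (hx N i).integral_comp (f := fun y => y ^ (2 * k)) hpm
  have hVar : ∀ i, Var[fun ω => x N ω i ^ (2 * k); P N] = V := by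
    intro i
    rw [(hlaw i).variance_eq, variance_map aemeasurable_id hpm.aemeasurable]
    rfl
  set S : Ω N → ℝ := fun ω => (∑ i, x N ω i ^ (2 * k)) / N with hS
  have hSmem : MemLp S 2 (P N) := by
    simpa only [hS, div_eq_inv_mul] using
      (memLp_finsetSum Finset.univ fun i _ => hxL2 i).const_mul (N : ℝ)⁻¹
  have hSE : ∫ ω, S ω ∂(P N) = m := by
    simp only [hS]
    rw [integral_div, integral_finsetSum _ fun i _ => (hxL2 i).integrable one_le_two]
    simp only [hE, Finset.sum_const, Finset.card_univ, Fintype.card_fin, nsmul_eq_mul]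
    field_simp
  have hSV : Var[S; P N] = V / N := by
    have h1 : Var[∑ i, (fun ω => x N ω i ^ (2 * k)); P N] = N * V := by
      rw [IndepFun.variance_sum (fun i _ => hxL2 i)]
      · simp [hVar]
      · intro i _ j _ hij
        exact ((hi N).indepFun hij).comp (φ := fun y : ℝ => y ^ (2 * k))
          (ψ := fun y : ℝ => y ^ (2 * k)) (by fun_prop) (by fun_prop)
    have h2 : S = fun ω => (N : ℝ)⁻¹ * (∑ i, (fun ω => x N ω i ^ (2 * k))) ω := by
      funext ω; simp [hS, div_eq_inv_mul]
    rw [h2, variance_const_mul, h1]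
    field_simp
  have hch := meas_ge_le_variance_div_sq hSmem (c := m / 2) (by positivity)
  rw [hSE, hSV] at hch
  refine (measureReal_mono (s₂ := {ω | m / 2 ≤ |S ω - m|}) ?_).trans
    ((ENNReal.toReal_le_of_le_ofReal (by positivity) hch).trans_eq (by field_simp))
  intro ω (hω : ¬ (m / 2 ≤ S ω ∧ S ω ≤ 3 / 2 * m))
  change m / 2 ≤ |S ω - m|
  by_contra! hlt
  rw [abs_lt] at hlt
  exact hω ⟨by linarith, by linarith⟩

/-- A lower bound for the probability of `A`, by subadditivity: no measurability is needed. -/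
theorem one_sub_le_measureReal {Ω : Type*} [MeasurableSpace Ω] {P : Measure Ω}
    [IsProbabilityMeasure P] {A B : Set Ω} {r : ℝ} (hB : P.real B ≤ r) (h : ∀ ω, ω ∉ B → ω ∈ A) :
    1 - r ≤ P.real A := by
  have h1 : P.real (A ∪ B) = 1 := by
    rw [show A ∪ B = Set.univ from Set.eq_univ_of_forall fun ω => by
      by_cases hω : ω ∈ B
      · exact Or.inr hω
      · exact Or.inl (h ω hω)]
    simp
  have := measureReal_union_le (μ := P) A B
  linarith

/-- Events hold with high probability as soon as the probabilities of their complements are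
`O(1/N)`. The finitely many remaining sizes are absorbed into the constant. -/
theorem withHighProbability_of_eventually {Ω : ℕ → Type*} [∀ N, MeasurableSpace (Ω N)]
    {P : ∀ N, Measure (Ω N)} [∀ N, IsProbabilityMeasure (P N)] {A B : ∀ N, Set (Ω N)} {C : ℝ}
    (hC : 0 ≤ C) (hB : ∀ N, 1 ≤ N → (P N).real (B N) ≤ C / N)
    (h : ∀ᶠ N in atTop, ∀ ω, ω ∉ B N → ω ∈ A N) : WithHighProbability P A := by
  obtain ⟨N₀, hN₀⟩ := eventually_atTop.1 h
  refine ⟨1, C + N₀ + 1, one_pos, by positivity, fun N hN => ?_⟩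
  have hN0 : (0 : ℝ) < N := by exact_mod_cast hN
  rw [Real.rpow_neg_one, ← div_eq_mul_inv]
  rcases le_or_gt N₀ N with hle | hlt
  · have h1 := one_sub_le_measureReal (hB N hN) (hN₀ N hle)
    have h2 : C / N ≤ (C + N₀ + 1) / N := by
      gcongr
      have : (0 : ℝ) ≤ N₀ := Nat.cast_nonneg _
      linarith
    linarith
  · refine le_trans ?_ measureReal_nonneg
    rw [sub_nonpos, one_le_div hN0]
    have : (N : ℝ) ≤ N₀ := by exact_mod_cast hlt.le
    linarith

/-- The spike is of order one exactly on the scale `relevantSNR k 1`. -/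
theorem spikeIsOrderOne_iff {ρ : Measure ℝ} [IsProbabilityMeasure ρ] {α : ℝ}
    (h : HasStretchedExpTails ρ α) (hρ : ρ ≠ Measure.dirac 0) {k : ℕ} (hk : 1 ≤ k) {θ : ℝ}
    (hθ : θ ≠ 0) {Ω : ℕ → Type*}
    [∀ N, MeasurableSpace (Ω N)] {P : ∀ N, Measure (Ω N)} [∀ N, IsProbabilityMeasure (P N)]
    {x : ∀ N, Ω N → Fin N → ℝ} (hx : ∀ N i, HasLaw (fun ω => x N ω i) ρ (P N))
    (hi : ∀ N, iIndepFun (fun (i : Fin N) ω => x N ω i) (P N)) (γ : ℕ → ℝ) :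
    SpikeIsOrderOne P k θ γ x ↔ γ =Θ[atTop] relevantSNR k 1 := by
  obtain ⟨m, C, hm, hC, hbad⟩ := exists_measureReal_empirical_moment_le h hρ k hx hi
  set t : ℝ := |θ| / (k.factorial : ℝ) with ht
  have ht0 : 0 < t := by positivity
  have hr0 : ∀ N : ℕ, 1 ≤ N → 0 < |relevantSNR k 1 N| := by
    intro N hN
    have hN0 : (0 : ℝ) < N := by exact_mod_cast hN
    rw [relevantSNR]; positivity
  constructor
  · rintro ⟨a, b, ha, hab, c, C', hc, hC', hA⟩
    -- for large `N` the two events of high probability intersect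
    have hev : ∀ᶠ N : ℕ in atTop, C' * (N : ℝ) ^ (-c) + C / N < 1 := by
      have h1 : Tendsto (fun N : ℕ => (N : ℝ) ^ (-c)) atTop (𝓝 0) :=
        (tendsto_rpow_neg_atTop hc).comp tendsto_natCast_atTop_atTop
      have h2 := (h1.const_mul C').add (tendsto_const_div_atTop_nhds_zero_nat C)
      rw [mul_zero, add_zero] at h2
      exact h2.eventually (gt_mem_nhds one_pos)
    have hkey : ∀ᶠ N : ℕ in atTop, a / (t * (3 / 2 * m)) ≤ (|γ N| / |relevantSNR k 1 N|) ^ k ∧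
        (|γ N| / |relevantSNR k 1 N|) ^ k ≤ b / (t * (m / 2)) := by
      filter_upwards [hev, eventually_ge_atTop 1] with N hN hN1
      obtain ⟨ω, hω, h1, h2⟩ : ∃ ω, (∃ l : ℝ, spectrum ℝ (spikeMatrix k θ (γ N) (x N ω)) \ {0} = {l}
          ∧ a ≤ |l| ∧ |l| ≤ b) ∧ (m / 2 ≤ (∑ i, x N ω i ^ (2 * k)) / N ∧
          (∑ i, x N ω i ^ (2 * k)) / N ≤ 3 / 2 * m) := by
        by_contra! hcon
        have h1 := hA N hN1
        have h2 := measureReal_mono (μ := P N) (s₁ := {ω | ∃ l : ℝ,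
          spectrum ℝ (spikeMatrix k θ (γ N) (x N ω)) \ {0} = {l} ∧ a ≤ |l| ∧ |l| ≤ b})
          (s₂ := {ω | ¬ (m / 2 ≤ (∑ i, x N ω i ^ (2 * k)) / N ∧
            (∑ i, x N ω i ^ (2 * k)) / N ≤ 3 / 2 * m)})
          (fun ω hω hS => not_le.2 (hcon ω hω hS.1) hS.2)
        have h3 := hbad N hN1
        linarith
      rw [exists_spectrum_spikeMatrix_iff ha, abs_spikeEigenvalue hk] at hω
      have hA0 : 0 ≤ (|γ N| / |relevantSNR k 1 N|) ^ k := by positivity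
      rw [div_le_iff₀ (by positivity), le_div_iff₀ (by positivity)]
      constructor
      · refine hω.1.trans ?_
        rw [mul_assoc]
        gcongr
      · refine le_trans ?_ hω.2
        rw [mul_assoc]
        gcongr
    have hpos1 : 0 < a / (t * (3 / 2 * m)) := by positivity
    constructor
    · refine IsBigO.of_bound (max 1 (b / (t * (m / 2)))) ?_
      filter_upwards [hkey, eventually_ge_atTop 1] with N hN hN1
      rw [Real.norm_eq_abs, Real.norm_eq_abs, ← div_le_iff₀ (hr0 N hN1)]
      by_contra! hlt
      have h1 := (max_lt_iff.1 hlt).1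
      have h2 := (max_lt_iff.1 hlt).2
      linarith [le_self_pow₀ h1.le (by omega : k ≠ 0)]
    · refine IsBigO.of_bound (min 1 (a / (t * (3 / 2 * m))))⁻¹ ?_
      filter_upwards [hkey, eventually_ge_atTop 1] with N hN hN1
      have hmin : 0 < min 1 (a / (t * (3 / 2 * m))) := lt_min one_pos hpos1
      rw [Real.norm_eq_abs, Real.norm_eq_abs, inv_mul_eq_div, le_div_iff₀ hmin, mul_comm,
        ← le_div_iff₀ (hr0 N hN1)]
      by_contra! hlt
      have h1 := (lt_min_iff.1 hlt).1
      have h2 := (lt_min_iff.1 hlt).2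
      have h0 : 0 ≤ |γ N| / |relevantSNR k 1 N| := by positivity
      linarith [pow_le_of_le_one h0 h1.le (by omega : k ≠ 0)]
  · rintro ⟨h1, h2⟩
    obtain ⟨c₂, hc₂, hb₂⟩ := h1.exists_pos
    obtain ⟨c₁, hc₁, hb₁⟩ := h2.exists_pos
    have hev : ∀ᶠ N : ℕ in atTop, c₁⁻¹ ≤ |γ N| / |relevantSNR k 1 N| ∧
        |γ N| / |relevantSNR k 1 N| ≤ c₂ := by
      filter_upwards [hb₁.bound, hb₂.bound, eventually_ge_atTop 1] with N h1 h2 hN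
      rw [Real.norm_eq_abs, Real.norm_eq_abs] at h1 h2
      rw [div_le_iff₀ (hr0 N hN), le_div_iff₀ (hr0 N hN), inv_mul_le_iff₀ hc₁]
      exact ⟨h1, h2⟩
    obtain ⟨N₁, hN₁⟩ := hev.exists
    have hle : c₁⁻¹ ≤ c₂ := hN₁.1.trans hN₁.2
    refine ⟨c₁⁻¹ ^ k * t * (m / 2), c₂ ^ k * t * (3 / 2 * m), by positivity, ?_, ?_⟩
    · gcongr
      linarith
    · refine withHighProbability_of_eventually hC hbad ?_
      filter_upwards [hev] with N hN ω hω
      have hω' : m / 2 ≤ (∑ i, x N ω i ^ (2 * k)) / N ∧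
        (∑ i, x N ω i ^ (2 * k)) / N ≤ 3 / 2 * m := not_not.1 hω
      refine (exists_spectrum_spikeMatrix_iff (by positivity)).2 ?_
      rw [abs_spikeEigenvalue hk]
      have hS : 0 ≤ (∑ i, x N ω i ^ (2 * k)) / (N : ℝ) := le_trans (by positivity) hω'.1
      constructor
      · exact mul_le_mul (mul_le_mul_of_nonneg_right (pow_le_pow_left₀ (by positivity) hN.1 k)
          ht0.le) hω'.1 (by positivity) (by positivity)
      · exact mul_le_mul (mul_le_mul_of_nonneg_right (pow_le_pow_left₀ (by positivity) hN.2 k)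
          ht0.le) hω'.2 hS (by positivity)

theorem relevantSNR_isTheta {k : ℕ} {γ₀ : ℝ} (hγ : γ₀ ≠ 0) :
    relevantSNR k γ₀ =Θ[atTop] relevantSNR k 1 := by
  have h : relevantSNR k γ₀ = fun N => γ₀ * relevantSNR k 1 N := by
    funext N; simp [relevantSNR]
  rw [h]
  exact (isTheta_refl _ _).const_mul_left hγ

/-! ### The Taylor expansion of the non-linear matrix -/

theorem IsSmoothWithIndex.infoCoeff_eq_zero {μ : Measure ℝ} {k : ℕ} {f : ℝ → ℝ}
    (h : IsSmoothWithIndex μ k f) {j : ℕ} (h1 : 1 ≤ j) (hj : j < k) : infoCoeff μ j f = 0 := by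
  by_contra hne
  exact absurd (h.index.2 ⟨h1, hne⟩) (not_le.2 hj)

/-- Entrywise Taylor expansion of the non-linear matrix. The coefficients of orders
`1, …, k - 1` vanish on average, and the average of the term of order `k` is the spike. -/
theorem nonlinearMatrix_eq_expansion {μ : Measure ℝ} {k : ℕ} {f : ℝ → ℝ}
    (hf : IsSmoothWithIndex μ k f) {N : ℕ} (hN : 1 ≤ N) (γ : ℝ) (x : Fin N → ℝ)
    (z : {p : Fin N × Fin N // p.1 ≤ p.2} → ℝ) :
    nonlinearMatrix μ f γ x (symMatrix z) =
      (1 / √(N : ℝ)) • symMatrix (fun p => f (z p) - ∫ t, f t ∂μ) +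
      spikeMatrix k (infoCoeff μ k f) γ x +
      (∑ l ∈ Finset.range k, ((γ / √N) ^ (l + 1) / ((l + 1).factorial : ℝ) / √N) •
        (Matrix.of fun i j => x i ^ (l + 1) * symMatrix (fun p => iteratedDeriv (l + 1) f (z p) -
          infoCoeff μ (l + 1) f) i j * x j ^ (l + 1)) +
      (1 / √(N : ℝ)) • Matrix.of fun i j => f (symMatrix z i j + γ / √N * x i * x j) -
        ∑ l ∈ Finset.range (k + 1), iteratedDeriv l f (symMatrix z i j) / (l.factorial : ℝ) *
          (γ / √N * x i * x j) ^ l) := by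
  have hk : 1 ≤ k := hf.index.1.1
  have hN0 : (0 : ℝ) < N := by exact_mod_cast hN
  have hs : 0 < √(N : ℝ) := Real.sqrt_pos.2 hN0
  ext i j
  set y : ℝ := γ / √N * x i * x j with hy
  set t : ℝ := z (upperIdx i j) with ht
  have hspike : spikeMatrix k (infoCoeff μ k f) γ x i j =
      1 / √N * (infoCoeff μ k f / (k.factorial : ℝ) * y ^ k) := by
    simp only [spikeMatrix, Matrix.smul_apply, Matrix.vecMulVec_apply, smul_eq_mul]
    have h1 : (N : ℝ) ^ ((k : ℝ) / 2 - 1 / 2) = √N ^ k / √N := by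
      rw [Real.rpow_sub hN0, ← Real.sqrt_eq_rpow, Real.sqrt_eq_rpow, ← Real.rpow_mul_natCast hN0.le]
      congr 2
      ring
    rw [h1, hy, mul_pow, mul_pow, div_pow]
    field_simp
  have hlead : ∑ l ∈ Finset.range k, infoCoeff μ (l + 1) f / ((l + 1).factorial : ℝ) * y ^ (l + 1) =
      infoCoeff μ k f / (k.factorial : ℝ) * y ^ k := by
    rw [Finset.sum_eq_single (k - 1)]
    · rw [Nat.sub_add_cancel hk]
    · intro l hl hne
      have hl' := Finset.mem_range.1 hl
      rw [hf.infoCoeff_eq_zero (by omega) (by omega), zero_div, zero_mul]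
    · intro h
      exact absurd (Finset.mem_range.2 (by omega)) h
  simp only [Matrix.add_apply, hspike, Matrix.sum_apply, Matrix.smul_apply, nonlinearMatrix,
    symMatrix, Matrix.of_apply, smul_eq_mul, ← ht, ← hy, Finset.sum_range_succ' _ k]
  have hterm : ∀ l : ℕ, (γ / √N) ^ (l + 1) / ((l + 1).factorial : ℝ) / √N *
      (x i ^ (l + 1) * (iteratedDeriv (l + 1) f t - infoCoeff μ (l + 1) f) * x j ^ (l + 1)) =
      1 / √N * (iteratedDeriv (l + 1) f t / ((l + 1).factorial : ℝ) * y ^ (l + 1)) -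
      1 / √N * (infoCoeff μ (l + 1) f / ((l + 1).factorial : ℝ) * y ^ (l + 1)) := by
    intro l
    rw [hy, mul_pow, mul_pow]
    ring
  simp only [hterm, Finset.sum_sub_distrib, ← Finset.mul_sum, hlead]
  simp only [iteratedDeriv_zero, Nat.factorial_zero, Nat.cast_one, div_one, pow_zero, mul_one]
  ring

/-- Bound for the error terms of `nonlinearMatrix_eq_expansion`, at a signal-to-noise ratio for
which `γ / √N = γ₀ ε` with `√N ε ^ k ≤ 1`. -/
theorem opNorm_expansion_error_le {N k : ℕ} {γ₀ ε h Mx T B : ℝ} (hε0 : 0 ≤ ε) (hε1 : ε ≤ 1)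
    (hεk : √N * ε ^ k ≤ 1) (hh : h = γ₀ * ε) (hMx : 1 ≤ Mx) (hT : 0 ≤ T) (hB : 0 ≤ B)
    {x : Fin N → ℝ} (hx : ∀ i, |x i| ≤ Mx) {A : ℕ → Matrix (Fin N) (Fin N) ℝ}
    (hA : ∀ l < k, opNorm (A l) ≤ T * √N) {R : Matrix (Fin N) (Fin N) ℝ}
    (hR : ∀ i j, |R i j| ≤ B * |h * x i * x j| ^ (k + 1)) :
    opNorm (∑ l ∈ Finset.range k, (h ^ (l + 1) / ((l + 1).factorial : ℝ) / √N) •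
        (Matrix.of fun i j => x i ^ (l + 1) * A l i j * x j ^ (l + 1)) + (1 / √(N : ℝ)) • R) ≤
      (1 + |γ₀|) ^ (k + 1) * Mx ^ (2 * (k + 1)) * (k * T + B) * ε := by
  set G : ℝ := (1 + |γ₀|) ^ (k + 1) * Mx ^ (2 * (k + 1)) with hG
  have hG0 : 0 ≤ G := by positivity
  have hpos : 0 ≤ |γ₀| := abs_nonneg _
  have hterm : ∀ l ∈ Finset.range k, opNorm ((h ^ (l + 1) / ((l + 1).factorial : ℝ) / √N) •
      (Matrix.of fun i j => x i ^ (l + 1) * A l i j * x j ^ (l + 1))) ≤ G * T * ε := by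
    intro l hl
    have hl' := Finset.mem_range.1 hl
    have h1 : opNorm (Matrix.of fun i j => x i ^ (l + 1) * A l i j * x j ^ (l + 1)) ≤
        Mx ^ (2 * (k + 1)) * (T * √N) := by
      refine (opNorm_of_mul_mul_le (d := fun i => x i ^ (l + 1)) (M := Mx ^ (l + 1))
        (by positivity) fun i => ?_).trans ?_
      · rw [abs_pow]
        exact pow_le_pow_left₀ (abs_nonneg _) (hx i) _
      · refine mul_le_mul ?_ (hA l hl') (opNorm_nonneg _) (by positivity)
        rw [← pow_mul]
        exact pow_le_pow_right₀ hMx (by omega)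
    have h2 : |h ^ (l + 1) / ((l + 1).factorial : ℝ) / √N| ≤ (1 + |γ₀|) ^ (k + 1) * ε / √N := by
      rw [abs_div, abs_of_nonneg (Real.sqrt_nonneg _), abs_div, Nat.abs_cast, abs_pow]
      refine div_le_div_of_nonneg_right ?_ (Real.sqrt_nonneg _)
      refine (div_le_self (by positivity)
        (by exact_mod_cast Nat.one_le_iff_ne_zero.2 (Nat.factorial_ne_zero _))).trans ?_
      rw [hh, abs_mul, abs_of_nonneg hε0, mul_pow]
      refine mul_le_mul ?_ (pow_le_of_le_one hε0 hε1 (by omega)) (by positivity) (by positivity)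
      calc |γ₀| ^ (l + 1) ≤ (1 + |γ₀|) ^ (l + 1) := by gcongr; linarith
        _ ≤ _ := pow_le_pow_right₀ (by linarith) (by omega)
    rw [opNorm_smul]
    refine (mul_le_mul h2 h1 (opNorm_nonneg _) (by positivity)).trans ?_
    rcases eq_or_ne (√(N : ℝ)) 0 with h0 | h0
    · rw [h0]
      simp only [div_zero, zero_mul]
      positivity
    · refine le_of_eq ?_
      rw [hG]
      field_simp
  have hrem : opNorm ((1 / √(N : ℝ)) • R) ≤ G * B * ε := by
    have h1 : ∀ i j, |R i j| ≤ B * (G * ε ^ (k + 1)) := by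
      intro i j
      refine (hR i j).trans (mul_le_mul_of_nonneg_left ?_ hB)
      have h2 : |h * x i * x j| ≤ (1 + |γ₀|) * Mx ^ 2 * ε := by
        rw [abs_mul, abs_mul, hh, abs_mul, abs_of_nonneg hε0]
        calc |γ₀| * ε * |x i| * |x j| ≤ (1 + |γ₀|) * ε * Mx * Mx := by
              gcongr
              · linarith
              · exact hx i
              · exact hx j
          _ = _ := by ring
      refine (pow_le_pow_left₀ (abs_nonneg _) h2 _).trans_eq ?_
      rw [mul_pow, mul_pow, ← pow_mul, hG]
    rw [opNorm_smul, abs_of_nonneg (by positivity)]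
    calc 1 / √N * opNorm R ≤ 1 / √N * (N * (B * (G * ε ^ (k + 1)))) := by
          refine mul_le_mul_of_nonneg_left (opNorm_le_of_abs_le (by positivity) h1) (by positivity)
      _ = (N / √N) * ε ^ k * (G * B * ε) := by ring
      _ = (√N * ε ^ k) * (G * B * ε) := by rw [Real.div_sqrt]
      _ ≤ 1 * (G * B * ε) := by gcongr
      _ = _ := one_mul _
  calc _ ≤ _ := opNorm_add_le _ _
    _ ≤ ∑ l ∈ Finset.range k, G * T * ε + G * B * ε :=
        add_le_add ((opNorm_sum_le _ _).trans (Finset.sum_le_sum hterm)) hrem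
    _ = _ := by
        rw [Finset.sum_const, Finset.card_range, nsmul_eq_mul]
        ring

/-! ### The normalized noise -/

/-- The normalization of `f(Z)`, as a function of `Z` and of an auxiliary variable. When `f(Z)` is
constant there is nothing to normalize, and the auxiliary variable is used instead. -/
noncomputable def normalizedNoise (μ : Measure ℝ) (f : ℝ → ℝ) (y : ℝ × ℝ) : ℝ :=
  if noiseLevel μ f = 0 then y.2 else (f y.1 - ∫ z, f z ∂μ) / noiseLevel μ f

theorem measurable_normalizedNoise {μ : Measure ℝ} {f : ℝ → ℝ} (hf : Measurable f) :
    Measurable (normalizedNoise μ f) := by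
  unfold normalizedNoise
  split_ifs
  · exact measurable_snd
  · fun_prop

theorem integral_sub_mean_sq {μ : Measure ℝ} [IsProbabilityMeasure μ] {f : ℝ → ℝ}
    (hf : MemLp f 2 μ) :
    ∫ z, (f z - ∫ t, f t ∂μ) ^ 2 ∂μ = infoCoeff μ 0 (fun z => f z ^ 2) - infoCoeff μ 0 f ^ 2 := by
  simp only [infoCoeff, iteratedDeriv_zero]
  rw [← variance_eq_integral hf.aemeasurable, variance_eq_sub hf]
  rfl

theorem noiseLevel_sq {μ : Measure ℝ} [IsProbabilityMeasure μ] {f : ℝ → ℝ} (hf : MemLp f 2 μ) :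
    noiseLevel μ f ^ 2 = ∫ z, (f z - ∫ t, f t ∂μ) ^ 2 ∂μ := by
  rw [noiseLevel, ← integral_sub_mean_sq hf, Real.sq_sqrt]
  exact integral_nonneg fun z => sq_nonneg _

/-- The scaled normalized noise is the centered `f(Z)`. When the noise level vanishes, this holds
because `f` is then almost surely equal to its mean. -/
theorem noiseLevel_mul_normalizedNoise {μ : Measure ℝ} [IsProbabilityMeasure μ] {f : ℝ → ℝ}
    (hf : MemLp f 2 μ) :
    ∀ᵐ z ∂μ, ∀ g, noiseLevel μ f * normalizedNoise μ f (z, g) = f z - ∫ t, f t ∂μ := by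
  by_cases h0 : noiseLevel μ f = 0
  · have h1 := noiseLevel_sq hf
    have hint : Integrable (fun z => (f z - ∫ t, f t ∂μ) ^ 2) μ :=
      (hf.sub (memLp_const _)).integrable_sq
    rw [h0, zero_pow two_ne_zero, eq_comm,
      integral_eq_zero_iff_of_nonneg (fun z => sq_nonneg _) hint] at h1
    filter_upwards [h1] with z hz g
    rw [h0, zero_mul]
    exact (pow_eq_zero_iff two_ne_zero).1 hz |>.symm
  · refine ae_of_all _ fun z g => ?_
    rw [normalizedNoise, if_neg h0, mul_div_cancel₀ _ h0]

theorem isNormalizedEntryLaw_map_normalizedNoise {μ : Measure ℝ} [IsProbabilityMeasure μ]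
    {f : ℝ → ℝ} (hfm : Measurable f) (hf : MemLp f 4 μ) :
    IsNormalizedEntryLaw ((μ.prod (gaussianReal 0 1)).map (normalizedNoise μ f)) := by
  have hf2 : MemLp f 2 μ := hf.mono_exponent (by norm_num)
  by_cases h0 : noiseLevel μ f = 0
  · have : normalizedNoise μ f = Prod.snd := by
      funext y; simp [normalizedNoise, h0]
    rw [this, show (μ.prod (gaussianReal 0 1)).map Prod.snd = gaussianReal 0 1 from
      Measure.snd_prod]
    refine ⟨inferInstance, memLp_id_gaussianReal 4, integral_id_gaussianReal, ?_⟩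
    have := variance_id_gaussianReal (μ := 0) (v := 1)
    rw [variance_eq_integral aemeasurable_id] at this
    simpa [integral_id_gaussianReal] using this
  · set g : ℝ → ℝ := fun z => (f z - ∫ t, f t ∂μ) / noiseLevel μ f with hg
    have hgm : Measurable g := by fun_prop
    have : normalizedNoise μ f = g ∘ Prod.fst := by
      funext y; simp [normalizedNoise, h0, hg]
    rw [this, ← Measure.map_map hgm measurable_fst,
      show (μ.prod (gaussianReal 0 1)).map Prod.fst = μ from Measure.fst_prod]
    refine ⟨Measure.isProbabilityMeasure_map hgm.aemeasurable, ?_, ?_, ?_⟩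
    · refine (memLp_map_measure_iff (by fun_prop) hgm.aemeasurable).2 ?_
      have := (hf.sub (memLp_const (∫ t, f t ∂μ))).const_mul (noiseLevel μ f)⁻¹
      refine this.ae_eq (ae_of_all _ fun z => ?_)
      simp [hg, div_eq_inv_mul]
    · rw [integral_map hgm.aemeasurable (by fun_prop)]
      simp only [hg]
      rw [integral_div, integral_sub (hf2.integrable one_le_two) (integrable_const _)]
      simp
    · rw [integral_map hgm.aemeasurable (by fun_prop)]
      simp only [hg, div_pow]
      rw [integral_div, ← noiseLevel_sq hf2, div_self (pow_ne_zero _ h0)]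

/-! ### The canonical probability space -/

/-- The joint law of the signal and of independent pairs, indexed by the positions on and above
the diagonal, of a noise variable of law `μ` and an auxiliary Gaussian variable. -/
noncomputable def signalNoiseMeasure (ρ μ : Measure ℝ) (N : ℕ) :
    Measure ((Fin N → ℝ) × ({p : Fin N × Fin N // p.1 ≤ p.2} → ℝ × ℝ)) :=
  (Measure.pi fun _ => ρ).prod (Measure.pi fun _ => μ.prod (gaussianReal 0 1))

section SignalNoise

variable (ρ μ : Measure ℝ) [IsProbabilityMeasure ρ] [IsProbabilityMeasure μ] (N : ℕ)

instance : IsProbabilityMeasure (signalNoiseMeasure ρ μ N) := by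
  unfold signalNoiseMeasure; infer_instance

theorem hasLaw_signal (i : Fin N) : HasLaw (fun ω => ω.1 i) ρ (signalNoiseMeasure ρ μ N) :=
  ((measurePreserving_eval (fun _ : Fin N => ρ) i).comp measurePreserving_fst).hasLaw

theorem hasLaw_noisePair (p : {p : Fin N × Fin N // p.1 ≤ p.2}) :
    HasLaw (fun ω => ω.2 p) (μ.prod (gaussianReal 0 1)) (signalNoiseMeasure ρ μ N) :=
  ((measurePreserving_eval (fun _ : {p : Fin N × Fin N // p.1 ≤ p.2} =>
    μ.prod (gaussianReal 0 1)) p).comp measurePreserving_snd).hasLaw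

theorem hasLaw_noise (p : {p : Fin N × Fin N // p.1 ≤ p.2}) :
    HasLaw (fun ω => (ω.2 p).1) μ (signalNoiseMeasure ρ μ N) :=
  measurePreserving_fst.fun_comp_hasLaw (hasLaw_noisePair ρ μ N p)

theorem iIndepFun_noisePair :
    iIndepFun (fun (p : {p : Fin N × Fin N // p.1 ≤ p.2})
      (ω : (Fin N → ℝ) × ({p : Fin N × Fin N // p.1 ≤ p.2} → ℝ × ℝ)) => ω.2 p)
      (signalNoiseMeasure ρ μ N) :=
  (iIndepFun_iff_hasLaw_pi_pi fun p => hasLaw_noisePair ρ μ N p).2 measurePreserving_snd.hasLaw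

/-- Once the auxiliary variables are forgotten, signal and noise have their prescribed joint law. -/
theorem hasLaw_signal_noise :
    HasLaw (fun ω : (Fin N → ℝ) × ({p : Fin N × Fin N // p.1 ≤ p.2} → ℝ × ℝ) =>
      (ω.1, fun p => (ω.2 p).1))
      ((Measure.pi fun _ => ρ).prod (Measure.pi fun _ => μ)) (signalNoiseMeasure ρ μ N) :=
  ((MeasurePreserving.id _).prod
    (measurePreserving_pi (fun _ => μ.prod (gaussianReal 0 1)) (fun _ => μ)
      fun _ => measurePreserving_fst)).hasLaw

end SignalNoise

/-- A signal and a noise matrix are determined, in law, by the signal and the entries of the noise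
on and above the diagonal. -/
theorem IsSignalAndNoise.hasLaw {N : ℕ} {Ω : Type*} [MeasurableSpace Ω] {P : Measure Ω}
    [IsProbabilityMeasure P] {ρ μ : Measure ℝ} {x : Ω → Fin N → ℝ}
    {Z : Ω → Matrix (Fin N) (Fin N) ℝ} (h : IsSignalAndNoise P ρ μ x Z) :
    HasLaw (fun ω => (x ω, fun p : {p : Fin N × Fin N // p.1 ≤ p.2} => Z ω p.1.1 p.1.2))
      ((Measure.pi fun _ => ρ).prod (Measure.pi fun _ => μ)) P := by
  have h1 : HasLaw x (Measure.pi fun _ => ρ) P := h.signal_indep.hasLaw_pi h.signal_law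
  have h2 : HasLaw (fun ω => fun p : {p : Fin N × Fin N // p.1 ≤ p.2} => Z ω p.1.1 p.1.2)
      (Measure.pi fun _ => μ) P :=
    h.noise.indep.hasLaw_pi fun p => h.noise.law p.1.1 p.1.2 p.2
  refine (indepFun_iff_hasLaw_prodMk_prod h1 h2).1 ?_
  exact h.indep.comp (φ := id) (ψ := fun (A : Fin N → Fin N → ℝ)
    (p : {p : Fin N × Fin N // p.1 ≤ p.2}) => A p.1.1 p.1.2) measurable_id (by fun_prop)

theorem eq_symMatrix_of_isSymm {N : ℕ} {A : Matrix (Fin N) (Fin N) ℝ} (hA : A.IsSymm) :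
    A = symMatrix fun p => A p.1.1 p.1.2 := by
  ext i j
  rcases le_total i j with h | h
  · simp [symMatrix, upperIdx, h]
  · simp only [symMatrix, upperIdx, h, Matrix.of_apply, min_eq_right, max_eq_left]
    exact hA.apply j i

/-! ### The spiked decomposition -/

/-- The noise matrix of the decomposition. -/
noncomputable def wignerPart {N : ℕ} (μ : Measure ℝ) (f : ℝ → ℝ)
    (ζ : {p : Fin N × Fin N // p.1 ≤ p.2} → ℝ × ℝ) : Matrix (Fin N) (Fin N) ℝ :=
  (1 / √(N : ℝ)) • symMatrix fun p => normalizedNoise μ f (ζ p)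

/-- What remains of the non-linear matrix once noise and spike are subtracted. -/
noncomputable def errorPart {N : ℕ} (μ : Measure ℝ) (f : ℝ → ℝ) (k : ℕ) (γ : ℝ)
    (ω : (Fin N → ℝ) × ({p : Fin N × Fin N // p.1 ≤ p.2} → ℝ × ℝ)) : Matrix (Fin N) (Fin N) ℝ :=
  nonlinearMatrix μ f γ ω.1 (symMatrix fun p => (ω.2 p).1) -
    noiseLevel μ f • wignerPart μ f ω.2 - spikeMatrix k (infoCoeff μ k f) γ ω.1

theorem sqrt_smul_wignerPart {N : ℕ} (hN : 1 ≤ N) (μ : Measure ℝ) (f : ℝ → ℝ)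
    (ζ : {p : Fin N × Fin N // p.1 ≤ p.2} → ℝ × ℝ) :
    √(N : ℝ) • wignerPart μ f ζ = symMatrix fun p => normalizedNoise μ f (ζ p) := by
  have hs : √(N : ℝ) ≠ 0 := (Real.sqrt_pos.2 (by exact_mod_cast hN)).ne'
  rw [wignerPart, smul_smul, mul_one_div_cancel hs, one_smul]

theorem errorPart_isSymm {N : ℕ} (μ : Measure ℝ) (f : ℝ → ℝ) (k : ℕ) (γ : ℝ)
    (ω : (Fin N → ℝ) × ({p : Fin N × Fin N // p.1 ≤ p.2} → ℝ × ℝ)) :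
    (errorPart μ f k γ ω).IsSymm := by
  ext i j
  simp only [errorPart, wignerPart, nonlinearMatrix, spikeMatrix, symMatrix, Matrix.transpose_apply,
    Matrix.sub_apply, Matrix.smul_apply, Matrix.of_apply, Matrix.vecMulVec_apply, smul_eq_mul,
    upperIdx_comm j i]
  rw [mul_right_comm _ (ω.1 j) (ω.1 i), mul_comm (ω.1 j ^ k / _)]

theorem isIidSymmetric_wignerPart {N : ℕ} (hN : 1 ≤ N) (ρ μ : Measure ℝ) [IsProbabilityMeasure ρ]
    [IsProbabilityMeasure μ] {f : ℝ → ℝ} (hf : Measurable f) :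
    IsIidSymmetric (signalNoiseMeasure ρ μ N)
      ((μ.prod (gaussianReal 0 1)).map (normalizedNoise μ f))
      (fun ω => √(N : ℝ) • wignerPart μ f ω.2) := by
  have hm := measurable_normalizedNoise (μ := μ) hf
  simp only [sqrt_smul_wignerPart hN]
  refine ⟨fun ω => symMatrix_isSymm _, fun i j _ => ?_, ?_⟩
  · exact HasLaw.fun_comp ⟨hm.aemeasurable, rfl⟩ (hasLaw_noisePair ρ μ N (upperIdx i j))
  · have := (iIndepFun_noisePair ρ μ N).comp (fun _ => normalizedNoise μ f) fun _ => hm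
    convert this using 3 with p
    simp [symMatrix, upperIdx_of_le p.2]

theorem indepFun_wignerPart_signal {N : ℕ} (ρ μ : Measure ℝ) [IsProbabilityMeasure ρ]
    [IsProbabilityMeasure μ] {f : ℝ → ℝ} (hf : Measurable f) :
    IndepFun (fun (ω : (Fin N → ℝ) × ({p : Fin N × Fin N // p.1 ≤ p.2} → ℝ × ℝ)) i j =>
      wignerPart μ f ω.2 i j) (fun ω => ω.1) (signalNoiseMeasure ρ μ N) := by
  have hm := measurable_normalizedNoise (μ := μ) hf
  refine (indepFun_prod (X := fun x : Fin N → ℝ => x)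
    (Y := fun (ζ : {p : Fin N × Fin N // p.1 ≤ p.2} → ℝ × ℝ) i j => wignerPart μ f ζ i j)
    measurable_id ?_).symm
  simp only [wignerPart, symMatrix, Matrix.smul_apply, Matrix.of_apply, smul_eq_mul]
  fun_prop

/-- The equality in law of the decomposition. By the definition of the error, both sides are the
same function of the signal and the noise. -/
theorem identDistrib_nonlinearMatrix {N : ℕ} {Ω : Type*} [MeasurableSpace Ω] {P : Measure Ω}
    [IsProbabilityMeasure P] {ρ μ : Measure ℝ} [IsProbabilityMeasure ρ] [IsProbabilityMeasure μ]
    {x : Ω → Fin N → ℝ} {Z : Ω → Matrix (Fin N) (Fin N) ℝ} (h : IsSignalAndNoise P ρ μ x Z)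
    {f : ℝ → ℝ} (hf : Measurable f) (k : ℕ) (γ : ℝ) :
    IdentDistrib (fun ω => (x ω, fun i j => nonlinearMatrix μ f γ (x ω) (Z ω) i j))
      (fun ω => (ω.1, fun i j => (noiseLevel μ f • wignerPart μ f ω.2 +
        spikeMatrix k (infoCoeff μ k f) γ ω.1 + errorPart μ f k γ ω) i j))
      P (signalNoiseMeasure ρ μ N) := by
  set Φ : (Fin N → ℝ) × ({p : Fin N × Fin N // p.1 ≤ p.2} → ℝ) →
      (Fin N → ℝ) × (Fin N → Fin N → ℝ) :=
    fun y => (y.1, fun i j => nonlinearMatrix μ f γ y.1 (symMatrix y.2) i j) with hΦ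
  have hΦm : Measurable Φ := by
    simp only [hΦ, nonlinearMatrix, symMatrix, Matrix.of_apply]
    fun_prop
  have hid := (h.hasLaw.identDistrib (hasLaw_signal_noise ρ μ N)).comp hΦm
  have h1 : (fun ω => (x ω, fun i j => nonlinearMatrix μ f γ (x ω) (Z ω) i j)) =
      Φ ∘ fun ω => (x ω, fun p : {p : Fin N × Fin N // p.1 ≤ p.2} => Z ω p.1.1 p.1.2) := by
    funext ω
    simp only [hΦ, Function.comp_apply, ← eq_symMatrix_of_isSymm (h.noise.symm ω)]
  have h2 : (fun ω : (Fin N → ℝ) × ({p : Fin N × Fin N // p.1 ≤ p.2} → ℝ × ℝ) =>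
      (ω.1, fun i j => (noiseLevel μ f • wignerPart μ f ω.2 +
        spikeMatrix k (infoCoeff μ k f) γ ω.1 + errorPart μ f k γ ω) i j)) =
      Φ ∘ fun ω => (ω.1, fun p => (ω.2 p).1) := by
    funext ω
    have : noiseLevel μ f • wignerPart μ f ω.2 + spikeMatrix k (infoCoeff μ k f) γ ω.1 +
        errorPart μ f k γ ω = nonlinearMatrix μ f γ ω.1 (symMatrix fun p => (ω.2 p).1) := by
      rw [errorPart]; abel
    rw [this]
    rfl
  rw [h1, h2]
  exact hid

/-- The centered matrices of derivatives in the Taylor expansion have norm at most `√N` up to a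
power of `log N`, simultaneously with high probability. -/
theorem exists_measureReal_opNorm_derivative_le {ρ μ : Measure ℝ} [IsProbabilityMeasure ρ]
    [IsProbabilityMeasure μ] {α : ℝ} (hμ : HasStretchedExpTails μ α) {k : ℕ} {f : ℝ → ℝ}
    (hf : IsSmoothWithIndex μ k f) :
    ∃ K : ℝ, 0 ≤ K ∧ ∀ N : ℕ, 1 ≤ N → (signalNoiseMeasure ρ μ N).real
      {ω | ∃ l < k, K * (1 + Real.log N) ^ (⌈1 / α⌉₊ * (k + 1)) * √N <
        opNorm (symMatrix fun p => iteratedDeriv (l + 1) f (ω.2 p).1 - infoCoeff μ (l + 1) f)} ≤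
      K / N := by
  obtain ⟨B, hB⟩ := hf.bounded
  have hone : ∀ l : Fin k, ∃ K : ℝ, 0 < K ∧ ∀ N : ℕ, 1 ≤ N → (signalNoiseMeasure ρ μ N).real
      {ω | K * √N * (1 + Real.log N) ^ (⌈1 / α⌉₊ * (k + 1)) <
        opNorm (symMatrix fun p => iteratedDeriv (l + 1) f (ω.2 p).1 - infoCoeff μ (l + 1) f)} ≤
      K / N := by
    intro l
    have hl : (l : ℕ) + 1 ≤ k := l.2
    obtain ⟨D, hD, hgrow⟩ := exists_abs_iteratedDeriv_le (hl.trans (Nat.le_succ k)) hf.contDiff hB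
    have hcont : Continuous (iteratedDeriv (l + 1) f) :=
      hf.contDiff.continuous_iteratedDeriv _ (by exact_mod_cast hl.trans (Nat.le_succ k))
    have hL2 : MemLp (iteratedDeriv (l + 1) f) 2 μ :=
      (hf.memLp _ hl).mono_exponent (by norm_num)
    have hgrow' : ∀ z, |iteratedDeriv (l + 1) f z - infoCoeff μ (l + 1) f| ≤
        (D + |infoCoeff μ (l + 1) f|) * (1 + |z|) ^ (k + 1) := by
      intro z
      refine (abs_sub _ _).trans ?_
      rw [add_mul]
      refine add_le_add (hgrow z) (le_mul_of_one_le_right (abs_nonneg _) (one_le_pow₀ ?_))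
      linarith [abs_nonneg z]
    have hmean : ∫ z, (iteratedDeriv (l + 1) f z - infoCoeff μ (l + 1) f) ∂μ = 0 := by
      rw [integral_sub (hL2.integrable one_le_two) (integrable_const _)]
      simp [infoCoeff]
    obtain ⟨K, hK, h⟩ := exists_measureReal_opNorm_symMatrix_le hμ
      (hcont.measurable.sub_const _) (by positivity) hgrow' (hL2.sub (memLp_const _)) hmean
    refine ⟨K, hK, fun N hN => h N _ (signalNoiseMeasure ρ μ N) (fun p ω => (ω.2 p).1) hN
      (fun p => by fun_prop) (hasLaw_noise ρ μ N) ?_⟩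
    exact (iIndepFun_noisePair ρ μ N).comp (fun _ => Prod.fst) fun _ => measurable_fst
  choose K hK h using hone
  refine ⟨∑ l, K l, Finset.sum_nonneg fun l _ => (hK l).le, fun N hN => ?_⟩
  have hlog := one_le_one_add_log hN
  have hsub : {ω | ∃ l < k, (∑ l, K l) * (1 + Real.log N) ^ (⌈1 / α⌉₊ * (k + 1)) * √N <
      opNorm (symMatrix fun p : {p : Fin N × Fin N // p.1 ≤ p.2} =>
        iteratedDeriv (l + 1) f ((ω : (Fin N → ℝ) ×
        ({p : Fin N × Fin N // p.1 ≤ p.2} → ℝ × ℝ)).2 p).1 - infoCoeff μ (l + 1) f)} ⊆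
      ⋃ l : Fin k, {ω | K l * √N * (1 + Real.log N) ^ (⌈1 / α⌉₊ * (k + 1)) <
        opNorm (symMatrix fun p => iteratedDeriv (l + 1) f (ω.2 p).1 -
          infoCoeff μ (l + 1) f)} := by
    rintro ω ⟨l, hl, hω⟩
    refine Set.mem_iUnion.2 ⟨⟨l, hl⟩, lt_of_le_of_lt ?_ hω⟩
    rw [mul_right_comm]
    gcongr
    exact Finset.single_le_sum (f := K) (fun l _ => (hK l).le) (Finset.mem_univ _)
  refine (measureReal_mono hsub).trans ((measureReal_iUnion_fintype_le _).trans ?_)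
  rw [Finset.sum_div]
  exact Finset.sum_le_sum fun l _ => h l N hN

theorem measureReal_exists_signal_gt_le {ρ μ : Measure ℝ} [IsProbabilityMeasure ρ]
    [IsProbabilityMeasure μ] {N : ℕ} (hN : 1 ≤ N) {M C : ℝ}
    (h : ρ.real {x | M < |x|} ≤ C / (N : ℝ) ^ 2) :
    (signalNoiseMeasure ρ μ N).real {ω | ∃ i, M < |ω.1 i|} ≤ C / N := by
  have hN0 : (0 : ℝ) < N := by exact_mod_cast hN
  have hsub : {ω : (Fin N → ℝ) × ({p : Fin N × Fin N // p.1 ≤ p.2} → ℝ × ℝ) | ∃ i, M < |ω.1 i|} ⊆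
      ⋃ i, {ω | M < |ω.1 i|} := fun ω ⟨i, hi⟩ => Set.mem_iUnion.2 ⟨i, hi⟩
  refine (measureReal_mono hsub).trans ((measureReal_iUnion_fintype_le _).trans ?_)
  calc _ ≤ ∑ _i : Fin N, C / (N : ℝ) ^ 2 := Finset.sum_le_sum fun i _ => by
        have := (hasLaw_signal ρ μ N i).measureReal_eq (p := fun x => M < |x|)
          (measurableSet_lt measurable_const (by fun_prop))
        exact this.trans_le h
    _ = C / N := by
        rw [Finset.sum_const, Finset.card_univ, Fintype.card_fin, nsmul_eq_mul]
        field_simp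

/-- The error of the spiked decomposition is small with high probability. -/
theorem withHighProbability_opNorm_errorPart_le {ρ μ : Measure ℝ} [IsProbabilityMeasure ρ]
    [IsProbabilityMeasure μ] {αX αZ : ℝ} (hρ : HasStretchedExpTails ρ αX)
    (hμ : HasStretchedExpTails μ αZ) {k : ℕ} {f : ℝ → ℝ} (hf : IsSmoothWithIndex μ k f) (γ₀ : ℝ) :
    ∃ K : ℝ, 0 < K ∧ WithHighProbability (signalNoiseMeasure ρ μ) fun N =>
      {ω | opNorm (errorPart μ f k (relevantSNR k γ₀ N) ω) ≤
        K * ((1 + Real.log N) ^ (⌈1 / αX⌉₊ * (2 * (k + 1)) + ⌈1 / αZ⌉₊ * (k + 1)) *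
          (N : ℝ) ^ (-(1 / (2 * (k : ℝ)))))} := by
  have hk : 1 ≤ k := hf.index.1.1
  have hk0 : (0 : ℝ) < k := by exact_mod_cast hk
  obtain ⟨B, hB⟩ := hf.bounded
  have hB0 : 0 ≤ B := (abs_nonneg _).trans (hB 0)
  obtain ⟨κ, C, hκ, hC, htail⟩ := hρ.exists_measureReal_le 2
  obtain ⟨K, hK, hder⟩ := exists_measureReal_opNorm_derivative_le (ρ := ρ) hμ hf
  have hf2 : MemLp f 2 μ := by
    simpa using (hf.memLp 0 (Nat.zero_le _)).mono_exponent (by norm_num : (2 : ENNReal) ≤ 4)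
  have hae : ∀ N, ∀ᵐ ω ∂signalNoiseMeasure ρ μ N, ∀ p : {p : Fin N × Fin N // p.1 ≤ p.2},
      noiseLevel μ f * normalizedNoise μ f (ω.2 p) = f (ω.2 p).1 - ∫ t, f t ∂μ := by
    intro N
    refine ae_all_iff.2 fun p => ?_
    have h1 := noiseLevel_mul_normalizedNoise hf2
    have hq : Measure.QuasiMeasurePreserving (fun ω : (Fin N → ℝ) ×
        ({p : Fin N × Fin N // p.1 ≤ p.2} → ℝ × ℝ) => (ω.2 p).1) (signalNoiseMeasure ρ μ N) μ :=
      ((hasLaw_noise ρ μ N p).measurePreserving (by fun_prop)).quasiMeasurePreserving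
    filter_upwards [hq.ae h1] with ω hω using hω _
  refine ⟨(1 + |γ₀|) ^ (k + 1) * (1 + κ) ^ (2 * (k + 1)) * (k * K + B + 1), by positivity, ?_⟩
  refine withHighProbability_of_eventually (C := C + K)
    (B := fun N => {ω | ∃ i, κ * (1 + Real.log N) ^ ⌈1 / αX⌉₊ < |ω.1 i|} ∪
      {ω | ∃ l < k, K * (1 + Real.log N) ^ (⌈1 / αZ⌉₊ * (k + 1)) * √N <
        opNorm (symMatrix fun p => iteratedDeriv (l + 1) f (ω.2 p).1 - infoCoeff μ (l + 1) f)} ∪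
      {ω | ¬ ∀ p : {p : Fin N × Fin N // p.1 ≤ p.2},
        noiseLevel μ f * normalizedNoise μ f (ω.2 p) = f (ω.2 p).1 - ∫ t, f t ∂μ})
    (by positivity) (fun N hN => ?_) ?_
  · refine (measureReal_union_le _ _).trans ?_
    have h0 : (signalNoiseMeasure ρ μ N).real {ω | ¬ ∀ p : {p : Fin N × Fin N // p.1 ≤ p.2},
        noiseLevel μ f * normalizedNoise μ f (ω.2 p) = f (ω.2 p).1 - ∫ t, f t ∂μ} = 0 := by
      rw [measureReal_def, ae_iff.1 (hae N), ENNReal.toReal_zero]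
    rw [h0, add_zero, add_div]
    exact (measureReal_union_le _ _).trans
      (add_le_add (measureReal_exists_signal_gt_le hN (htail N hN)) (hder N hN))
  · filter_upwards [eventually_ge_atTop 1] with N hN ω hω
    rw [Set.mem_union, Set.mem_union, not_or, not_or] at hω
    obtain ⟨⟨hx, hA⟩, hW⟩ := hω
    have hx' : ∀ i, |ω.1 i| ≤ κ * (1 + Real.log N) ^ ⌈1 / αX⌉₊ := fun i =>
      not_lt.1 fun h => hx ⟨i, h⟩
    have hA' : ∀ l < k, opNorm (symMatrix fun p => iteratedDeriv (l + 1) f (ω.2 p).1 -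
        infoCoeff μ (l + 1) f) ≤ K * (1 + Real.log N) ^ (⌈1 / αZ⌉₊ * (k + 1)) * √N :=
      fun l hl => not_lt.1 fun h => hA ⟨l, hl, h⟩
    have hW' := not_not.1 hW
    have hN0 : (0 : ℝ) < N := by exact_mod_cast hN
    have hN1 : (1 : ℝ) ≤ N := by exact_mod_cast hN
    have hl := one_le_one_add_log hN
    set lam : ℝ := 1 + Real.log N with hlam
    set γ := relevantSNR k γ₀ N with hγ
    set ε : ℝ := (N : ℝ) ^ (-(1 / (2 * (k : ℝ)))) with hε
    have hW'' : noiseLevel μ f • wignerPart μ f ω.2 =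
        (1 / √(N : ℝ)) • symMatrix (fun p => f (ω.2 p).1 - ∫ t, f t ∂μ) := by
      rw [wignerPart, smul_comm]
      congr 1
      ext i j
      simpa [symMatrix] using hW' (upperIdx i j)
    have hE : errorPart μ f k γ ω = ∑ l ∈ Finset.range k,
        ((γ / √N) ^ (l + 1) / ((l + 1).factorial : ℝ) / √N) •
        (Matrix.of fun i j => ω.1 i ^ (l + 1) * symMatrix (fun p =>
          iteratedDeriv (l + 1) f (ω.2 p).1 - infoCoeff μ (l + 1) f) i j * ω.1 j ^ (l + 1)) +
        (1 / √(N : ℝ)) • Matrix.of fun i j =>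
          f (symMatrix (fun p => (ω.2 p).1) i j + γ / √N * ω.1 i * ω.1 j) -
          ∑ l ∈ Finset.range (k + 1), iteratedDeriv l f (symMatrix (fun p => (ω.2 p).1) i j) /
            (l.factorial : ℝ) * (γ / √N * ω.1 i * ω.1 j) ^ l := by
      rw [errorPart, hW'', nonlinearMatrix_eq_expansion hf hN γ ω.1 fun p => (ω.2 p).1]
      abel
    have hεk : √N * ε ^ k ≤ 1 := by
      rw [hε, ← Real.rpow_mul_natCast hN0.le, Real.sqrt_eq_rpow, ← Real.rpow_add hN0]
      have : (1 : ℝ) / 2 + -(1 / (2 * (k : ℝ))) * k = 0 := by field_simp; ring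
      rw [this, Real.rpow_zero]
    have hpow1 : 1 ≤ lam ^ ⌈1 / αX⌉₊ := one_le_pow₀ hl
    have hbound := opNorm_expansion_error_le (N := N) (k := k) (γ₀ := γ₀) (ε := ε) (h := γ / √N)
      (Mx := (1 + κ) * lam ^ ⌈1 / αX⌉₊) (T := K * lam ^ (⌈1 / αZ⌉₊ * (k + 1))) (B := B)
      (by positivity) (Real.rpow_le_one_of_one_le_of_nonpos hN1 (by simp)) hεk
      (relevantSNR_div_sqrt hN γ₀) (by nlinarith) (by positivity) hB0 (x := ω.1)
      (fun i => (hx' i).trans (by gcongr; linarith))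
      (A := fun l => symMatrix (fun p => iteratedDeriv (l + 1) f (ω.2 p).1 -
        infoCoeff μ (l + 1) f)) hA'
      (R := Matrix.of fun i j => f (symMatrix (fun p => (ω.2 p).1) i j + γ / √N * ω.1 i * ω.1 j) -
          ∑ l ∈ Finset.range (k + 1), iteratedDeriv l f (symMatrix (fun p => (ω.2 p).1) i j) /
            (l.factorial : ℝ) * (γ / √N * ω.1 i * ω.1 j) ^ l)
      (fun i j => abs_sub_taylor_le (k + 1) hf.contDiff hB _ _)
    change opNorm (errorPart μ f k γ ω) ≤ _
    rw [hE]
    refine hbound.trans ?_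
    have hpow2 : 1 ≤ lam ^ (⌈1 / αZ⌉₊ * (k + 1)) := one_le_pow₀ hl
    have hfac : k * (K * lam ^ (⌈1 / αZ⌉₊ * (k + 1))) + B ≤
        (k * K + B + 1) * lam ^ (⌈1 / αZ⌉₊ * (k + 1)) := by
      have := le_mul_of_one_le_right hB0 hpow2
      nlinarith
    calc _ ≤ (1 + |γ₀|) ^ (k + 1) * ((1 + κ) * lam ^ ⌈1 / αX⌉₊) ^ (2 * (k + 1)) *
          ((k * K + B + 1) * lam ^ (⌈1 / αZ⌉₊ * (k + 1))) * ε := by gcongr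
      _ = _ := by
          rw [mul_pow, ← pow_mul, pow_add]
          ring

theorem hasSpikedDecomposition_relevantSNR {ρ μ : Measure ℝ} [IsProbabilityMeasure ρ]
    [IsProbabilityMeasure μ] {αX αZ : ℝ} (hρ : HasStretchedExpTails ρ αX)
    (hμ : HasStretchedExpTails μ αZ) {k : ℕ} {f : ℝ → ℝ} (hf : IsSmoothWithIndex μ k f) (γ₀ : ℝ)
    {Ω : ℕ → Type*} [∀ N, MeasurableSpace (Ω N)] {P : ∀ N, Measure (Ω N)}
    [∀ N, IsProbabilityMeasure (P N)] {x : ∀ N, Ω N → Fin N → ℝ}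
    {Z : ∀ N, Ω N → Matrix (Fin N) (Fin N) ℝ}
    (h : ∀ N, IsSignalAndNoise (P N) ρ μ (x N) (Z N)) :
    HasSpikedDecomposition P μ f k (relevantSNR k γ₀)
      (fun N => (1 + Real.log N) ^ (⌈1 / αX⌉₊ * (2 * (k + 1)) + ⌈1 / αZ⌉₊ * (k + 1)) *
        (N : ℝ) ^ (-(1 / (2 * (k : ℝ))))) x Z := by
  have hfm : Measurable f := hf.contDiff.continuous.measurable
  have hf4 : MemLp f 4 μ := by simpa using hf.memLp 0 (Nat.zero_le _)
  exact ⟨(μ.prod (gaussianReal 0 1)).map (normalizedNoise μ f),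
    fun N => (Fin N → ℝ) × ({p : Fin N × Fin N // p.1 ≤ p.2} → ℝ × ℝ), fun N => inferInstance,
    signalNoiseMeasure ρ μ, fun N ω => ω.1, fun N ω => wignerPart μ f ω.2,
    fun N ω => errorPart μ f k (relevantSNR k γ₀ N) ω,
    isNormalizedEntryLaw_map_normalizedNoise hfm hf4,
    fun N hN => ⟨inferInstance, isIidSymmetric_wignerPart hN ρ μ hfm,
      indepFun_wignerPart_signal ρ μ hfm, fun ω => errorPart_isSymm μ f k _ ω,
      identDistrib_nonlinearMatrix (h N) hfm k _⟩,
    withHighProbability_opNorm_errorPart_le hρ hμ hf γ₀⟩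

theorem HasInfoIndex.one_le {μ : Measure ℝ} {k : ℕ} {θ : ℝ} {f : ℝ → ℝ}
    (h : HasInfoIndex μ k θ f) : 1 ≤ k :=
  h.elim (fun h => h.index_pos) fun h => h.1.index.1.1

theorem HasInfoIndex.coeff_ne_zero {μ : Measure ℝ} {k : ℕ} {θ : ℝ} {f : ℝ → ℝ}
    (h : HasInfoIndex μ k θ f) : θ ≠ 0 :=
  h.elim (fun h => h.coeff_ne_zero) fun h => h.2 ▸ h.1.index.1.2

theorem corollary2p3 (αX αZ : ℝ) (k : ℕ) :
    ∃ Q : Polynomial ℝ,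
      ∀ (ρX μ : Measure ℝ) (f : ℝ → ℝ) (Ω : ℕ → Type*) [∀ N, MeasurableSpace (Ω N)]
        (P : ∀ N, Measure (Ω N)) (x : ∀ N, Ω N → Fin N → ℝ)
        (Z : ∀ N, Ω N → Matrix (Fin N) (Fin N) ℝ),
        IsProbabilityMeasure ρX → IsProbabilityMeasure μ → (∀ N, IsProbabilityMeasure (P N)) →
        HasStretchedExpTails ρX αX → ρX ≠ Measure.dirac 0 →
        HasStretchedExpTails μ αZ →
        (∀ N, IsSignalAndNoise (P N) ρX μ (x N) (Z N)) →
        (∀ θ : ℝ, HasInfoIndex μ k θ f →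
          (∀ γ₀ : ℝ, IsAdmissibleSNR k (relevantSNR k γ₀)) ∧
          (∀ γ₀ : ℝ, γ₀ ≠ 0 → SpikeIsOrderOne P k θ (relevantSNR k γ₀) x) ∧
          (∀ γ : ℕ → ℝ, SpikeIsOrderOne P k θ γ x ↔ γ =Θ[atTop] relevantSNR k 1)) ∧
        (IsSmoothWithIndex μ k f →
          ∀ γ₀ : ℝ,
            HasSpikedDecomposition P μ f k (relevantSNR k γ₀)
              (fun N => Q.eval (Real.log N) * (N : ℝ) ^ (-(1 / (2 * (k : ℝ))))) x Z ∧
            Tendsto (fun N : ℕ => Q.eval (Real.log N) * (N : ℝ) ^ (-(1 / (2 * (k : ℝ)))))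
              atTop (𝓝 0)) := by
  refine ⟨(1 + Polynomial.X) ^ (⌈1 / αX⌉₊ * (2 * (k + 1)) + ⌈1 / αZ⌉₊ * (k + 1)), ?_⟩
  intro ρX μ f Ω _ P x Z _ _ _ hρ hρ0 hμ h
  refine ⟨fun θ hθ => ?_, fun hf γ₀ => ⟨?_, ?_⟩⟩
  · have hiff := spikeIsOrderOne_iff hρ hρ0 hθ.one_le hθ.coeff_ne_zero
      (fun N => (h N).signal_law) fun N => (h N).signal_indep
    exact ⟨isAdmissibleSNR_relevantSNR hθ.one_le,
      fun γ₀ hγ₀ => (hiff _).2 (relevantSNR_isTheta hγ₀), hiff⟩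
  · simpa only [Polynomial.eval_pow, Polynomial.eval_add, Polynomial.eval_one, Polynomial.eval_X]
      using hasSpikedDecomposition_relevantSNR hρ hμ hf γ₀ h
  · have hk : (0 : ℝ) < k := by exact_mod_cast hf.index.1.1
    exact tendsto_eval_log_mul_rpow_neg _ (by positivity)
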